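/- \textbf{Theorem 3.} For $q\ge 3$ let $\delta_q$ be the infimum of the constants $c$ such that $q$-SAT on formulas with $n$ variables and $m$ clauses can be decided in time $2^{cn}m^{O(1)}$; the Strong Exponential-Time Hypothesis (SETH) states that $\lim_{q\to\infty}\delta_q=1$. For a matroid $M$ with ground set $U$ and rank function $r$, let $\lambda_M(X)=r(X)+r(U\setminus X)-r(U)+1$ for $X\subseteq U$. A branch decomposition of $M$ is a cubic tree $T$ (every vertex that is not a leaf has degree $3$) together with a bijection from $U$ to the leaves of $T$; the width of an edge $e$ of $T$ is $\lambda_M(X_e)$, where $(X_e,U\setminus X_e)$ is the partition of $U$ induced by the two components of $T-e$, and the width of the decomposition is the maximum width of its edges. The path-width of $M$ is the minimum width of a branch decomposition of $M$ whose tree is a caterpillar, i.e. consists of a path and of leaves attached to vertices of the path. Let (IP) be the problem to decide, for an integer $m\times n$ matrix $A$ and an integer vector $b=(b_1,\dots,b_m)$, whether there is a non-negative integer vector $x$ with $Ax=b$. Assume SETH. Then for every function $f$, every $\varepsilon>0$ and every constant $a$, no algorithm solves (IP) in time $$f(k)\,(d+1)^{(1-\varepsilon)k}\,(mn\beta)^{a},$$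 even when $A$ and $b$ are restricted to have non-negative entries (and $m,n\ge 1$), where $d=\max\{b_1,\dots,b_m\}$, $k$ is the path-width of the column matroid of $A$ over $\mathbb R$, and $\beta\ge 1$ is the bit length of the largest entry of $A$ and $b$. In particular, (IP) cannot be solved in time $f(k)(d+1)^{(1-\varepsilon)k}(mn)^{O(1)}$. Running times are those of a deterministic random access machine with logarithmic cost (every use of a number is charged its bit length). -/

import Mathlib

/-! ### Path-width of matroids -/

/-- A leaf of a tree: a vertex of degree at most one (degree zero occurs only in the tree with a
single vertex). -/
def IsTreeLeaf {V : Type*} (T : SimpleGraph V) (v : V) : Prop :=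
  (T.neighborSet v).ncard ≤ 1

/-- A cubic tree: all vertices that are not leaves have degree three. -/
def IsCubicTree {V : Type*} (T : SimpleGraph V) : Prop :=
  T.IsTree ∧ ∀ v, ¬ IsTreeLeaf T v → (T.neighborSet v).ncard = 3

/-- A caterpillar: a tree consisting of a path and of leaves attached to vertices of the path. -/
def IsCaterpillar {V : Type*} (T : SimpleGraph V) : Prop :=
  T.IsTree ∧ ∃ (u v : V) (p : T.Walk u v), p.IsPath ∧
    ∀ w, w ∉ p.support → ∃ x ∈ p.support, T.neighborSet w = {x}

namespace Matroid

/-- The connectivity function `λ_M(X) = r_M(X) + r_M(U \ X) - r_M(U) + 1`. It is used for finite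
matroids, where all the ranks are natural numbers. -/
noncomputable def pwConnectivity {α : Type*} (M : Matroid α) (X : Set α) : ℤ :=
  ((M.eRk X).toNat : ℤ) + ((M.eRk (M.E \ X)).toNat : ℤ) - ((M.eRk M.E).toNat : ℤ) + 1

/-- `(T, μ)` is a branch decomposition of `M`: `T` is a cubic tree and `μ` maps the elements of `M`
bijectively to the leaves of `T`. -/
def IsBranchDecomposition {α V : Type*} (M : Matroid α) (T : SimpleGraph V) (μ : α → V) : Prop :=
  IsCubicTree T ∧ Set.BijOn μ M.E {v | IsTreeLeaf T v}

/-- The branch decomposition `(T, μ)` has width at most `w`: for every edge `uv` of `T`, the set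
`X` of the elements whose leaves lie in the component of `u` of `T - uv` has `λ_M(X) ≤ w`. -/
def BranchWidthLE {α V : Type*} (M : Matroid α) (T : SimpleGraph V) (μ : α → V) (w : ℕ) : Prop :=
  ∀ u v, T.Adj u v →
    M.pwConnectivity {x ∈ M.E | (T.deleteEdges {s(u, v)}).Reachable u (μ x)} ≤ (w : ℤ)

/-- The path-width of a finite matroid: the minimum width of a branch decomposition `(T, μ)` in
which `T` is a (finite, cubic) caterpillar. -/
noncomputable def pathWidth {α : Type*} (M : Matroid α) : ℕ :=
  sInf {w : ℕ | ∃ (V : Type) (_ : Finite V) (T : SimpleGraph V) (μ : α → V),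
    M.IsBranchDecomposition T μ ∧ IsCaterpillar T ∧ M.BranchWidthLE T μ w}

end Matroid

/-- The column matroid of a real matrix: its elements are the (indices of the) columns, and a set of
columns is independent if it is linearly independent. -/
noncomputable def columnMatroid {m n : ℕ} (A : Matrix (Fin m) (Fin n) ℝ) : Matroid (Fin n) :=
  (IndepMatroid.ofFinite (E := Set.univ) Set.finite_univ
    (fun I => LinearIndepOn ℝ A.col I)
    (linearIndepOn_empty ℝ _)
    (fun _ _ hJ hIJ => hJ.mono hIJ)
    (by
      intro I J hI hJ hlt
      by_contra! hcon
      have hsub : A.col '' J ⊆ (Submodule.span ℝ (A.col '' I) : Set (Fin m → ℝ)) := by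
        rintro _ ⟨e, he, rfl⟩
        by_contra hn
        have heI : e ∉ I := fun h => hn (Submodule.subset_span ⟨e, h, rfl⟩)
        exact hcon e he heI (hI.insert hn)
      have hle := Submodule.finrank_mono (Submodule.span_le.2 hsub)
      have key : ∀ K : Set (Fin n), LinearIndepOn ℝ A.col K →
          Module.finrank ℝ (Submodule.span ℝ (A.col '' K)) = K.ncard := by
        intro K hK
        classical
        have h := finrank_span_eq_card (R := ℝ) (b := fun i : K => A.col i) hK
        rw [Set.image_eq_range, h, Set.ncard_eq_toFinset_card', Set.toFinset_card]
      rw [key I hI, key J hJ] at hle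
      omega)
    (fun _ _ => Set.subset_univ _)).matroid

/-! ### Random access machines with logarithmic cost

Programs of a random access machine in structured form. A program uses finitely many registers and
finitely many arrays, all of them holding natural numbers of unbounded size. Every use of a number
(operand, result or array index) is charged its bit length, so that the running time counts bit
operations. Multiplication and division are available as in the usual random access machine. -/

namespace RAM

/-- The content of the memory: registers `reg x`, and arrays `arr c` with entries `arr c i`. -/
structure State where
  reg : ℕ → ℕ
  arr : ℕ → ℕ → ℕ

/-- Expressions; `sub` is truncated subtraction and `div` is division with rounding down. -/
inductive Expr
  | lit (c : ℕ)
  | reg (x : ℕ)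
  | get (c : ℕ) (i : Expr)
  | add (e₁ e₂ : Expr)
  | sub (e₁ e₂ : Expr)
  | mul (e₁ e₂ : Expr)
  | div (e₁ e₂ : Expr)

/-- The value of an expression. -/
def Expr.eval (σ : State) : Expr → ℕ
  | lit c => c
  | reg x => σ.reg x
  | get c i => σ.arr c (i.eval σ)
  | add e₁ e₂ => e₁.eval σ + e₂.eval σ
  | sub e₁ e₂ => e₁.eval σ - e₂.eval σ
  | mul e₁ e₂ => e₁.eval σ * e₂.eval σ
  | div e₁ e₂ => e₁.eval σ / e₂.eval σ

/-- The cost of evaluating an expression: every subexpression contributes one plus the number of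
bits of its value. -/
def Expr.cost (σ : State) : Expr → ℕ
  | lit c => 1 + Nat.size c
  | reg x => 1 + Nat.size (σ.reg x)
  | get c i => i.cost σ + 1 + Nat.size (σ.arr c (i.eval σ))
  | add e₁ e₂ => e₁.cost σ + e₂.cost σ + 1 + Nat.size (e₁.eval σ + e₂.eval σ)
  | sub e₁ e₂ => e₁.cost σ + e₂.cost σ + 1 + Nat.size (e₁.eval σ - e₂.eval σ)
  | mul e₁ e₂ => e₁.cost σ + e₂.cost σ + 1 + Nat.size (e₁.eval σ * e₂.eval σ)
  | div e₁ e₂ => e₁.cost σ + e₂.cost σ + 1 + Nat.size (e₁.eval σ / e₂.eval σ)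

/-- Programs. A condition holds if its value is not zero. -/
inductive Prog
  | skip
  | assign (x : ℕ) (e : Expr)
  | store (c : ℕ) (i e : Expr)
  | seq (P Q : Prog)
  | ite (e : Expr) (P Q : Prog)
  | while (e : Expr) (P : Prog)

/-- The memory after writing `v` into register `x`. -/
def State.setReg (σ : State) (x v : ℕ) : State :=
  { σ with reg := Function.update σ.reg x v }

/-- The memory after writing `v` into entry `i` of array `c`. -/
def State.setArr (σ : State) (c i v : ℕ) : State :=
  { σ with arr := Function.update σ.arr c (Function.update (σ.arr c) i v) }

/-- `Exec P σ t σ'`: the program `P`, started with memory `σ`, halts with memory `σ'`, and its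
running time is `t`. -/
inductive Exec : Prog → State → ℕ → State → Prop
  | skip (σ : State) : Exec .skip σ 1 σ
  | assign (σ : State) (x : ℕ) (e : Expr) :
      Exec (.assign x e) σ (e.cost σ + 1) (σ.setReg x (e.eval σ))
  | store (σ : State) (c : ℕ) (i e : Expr) :
      Exec (.store c i e) σ (i.cost σ + e.cost σ + 1) (σ.setArr c (i.eval σ) (e.eval σ))
  | seq {P Q : Prog} {σ₁ σ₂ σ₃ : State} {t₁ t₂ : ℕ} :
      Exec P σ₁ t₁ σ₂ → Exec Q σ₂ t₂ σ₃ → Exec (.seq P Q) σ₁ (t₁ + t₂) σ₃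
  | ite_true {e : Expr} {P Q : Prog} {σ σ' : State} {t : ℕ} :
      e.eval σ ≠ 0 → Exec P σ t σ' → Exec (.ite e P Q) σ (e.cost σ + 1 + t) σ'
  | ite_false {e : Expr} {P Q : Prog} {σ σ' : State} {t : ℕ} :
      e.eval σ = 0 → Exec Q σ t σ' → Exec (.ite e P Q) σ (e.cost σ + 1 + t) σ'
  | while_true {e : Expr} {P : Prog} {σ₁ σ₂ σ₃ : State} {t₁ t₂ : ℕ} :
      e.eval σ₁ ≠ 0 → Exec P σ₁ t₁ σ₂ → Exec (.while e P) σ₂ t₂ σ₃ →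
      Exec (.while e P) σ₁ (e.cost σ₁ + 1 + t₁ + t₂) σ₃
  | while_false {e : Expr} {P : Prog} {σ : State} :
      e.eval σ = 0 → Exec (.while e P) σ (e.cost σ + 1) σ

/-- Started with memory `σ`, the program `P` halts within time `T`, and the content of register `0`
is then nonzero exactly if the answer `Q` is "yes". -/
def DecidesWithin (P : Prog) (σ : State) (Q : Prop) (T : ℝ) : Prop :=
  ∃ (t : ℕ) (σ' : State), Exec P σ t σ' ∧ (t : ℝ) ≤ T ∧ (σ'.reg 0 ≠ 0 ↔ Q)

/-- The memory in which registers `0` and `1` hold `x₀` and `x₁`, arrays `0` and `1` hold `a₀` and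
`a₁`, and everything else is zero. -/
def input (x₀ x₁ : ℕ) (a₀ a₁ : ℕ → ℕ) : State where
  reg := fun x => if x = 0 then x₀ else if x = 1 then x₁ else 0
  arr := fun c => if c = 0 then a₀ else if c = 1 then a₁ else fun _ => 0

end RAM

/-! ### Satisfiability and the Strong Exponential-Time Hypothesis -/

/-- A formula in conjunctive normal form with `n` variables: a list of clauses, where a clause is a
list of literals and `(v, true)`, `(v, false)` are the literals `v` and `¬ v`. -/
abbrev CNFFormula (n : ℕ) := List (List (Fin n × Bool))

namespace CNFFormula

/-- Some assignment satisfies a literal of every clause. -/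
def Satisfiable {n : ℕ} (ψ : CNFFormula n) : Prop :=
  ∃ φ : Fin n → Bool, ∀ C ∈ ψ, ∃ l ∈ C, φ l.1 = l.2

/-- The formula as a sequence of numbers: the literals `¬ v` and `v` are written as `2v + 1` and
`2v + 2`, and every clause is followed by a `0`. -/
def encode {n : ℕ} (ψ : CNFFormula n) : List ℕ :=
  ψ.flatMap fun C => C.map (fun l => 2 * (l.1 : ℕ) + if l.2 then 2 else 1) ++ [0]

/-- The input of a satisfiability algorithm: the number of variables in register `0`, the number of
clauses in register `1`, and the formula in array `0`. -/
def toInput {n : ℕ} (ψ : CNFFormula n) : RAM.State :=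
  RAM.input n ψ.length (fun i => ψ.encode.getD i 0) (fun _ => 0)

end CNFFormula

/-- There is an algorithm that solves `q`-SAT (every clause has at most `q` literals) on formulas
with `n` variables and `m` clauses in time `2 ^ (c n) * m ^ O(1)`. The factor `C` and the summand
`1` let the bound make sense also for `m ≤ 1`. -/
def QSatSolvable (q : ℕ) (c : ℝ) : Prop :=
  ∃ (P : RAM.Prog) (C : ℝ) (a : ℕ), ∀ (n : ℕ) (ψ : CNFFormula n), (∀ K ∈ ψ, K.length ≤ q) →
    RAM.DecidesWithin P ψ.toInput ψ.Satisfiable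
      (C * (2 : ℝ) ^ (c * (n : ℝ)) * ((ψ.length : ℝ) + 1) ^ a)

/-- The infimum `δ_q` of the constants `c` such that `q`-SAT can be solved in time
`2 ^ (c n) * m ^ O(1)`. -/
noncomputable def qSatExponent (q : ℕ) : ℝ :=
  sInf {c : ℝ | 0 ≤ c ∧ QSatSolvable q c}

/-- The Strong Exponential-Time Hypothesis: `δ_q` tends to `1` as `q` tends to infinity. -/
def SETH : Prop :=
  Filter.Tendsto qSatExponent Filter.atTop (nhds 1)

/-! ### Integer programming with a non-negative constraint matrix -/

namespace IP

/-- `A x = b` has a solution `x` in non-negative integers. -/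
def Feasible {m n : ℕ} (A : Matrix (Fin m) (Fin n) ℕ) (b : Fin m → ℕ) : Prop :=
  ∃ x : Fin n → ℕ, A.mulVec x = b

/-- The largest entry of `b`. -/
def maxEntry {m : ℕ} (b : Fin m → ℕ) : ℕ :=
  Finset.univ.sup b

/-- The path-width of the column matroid of `A`. -/
noncomputable def columnPathWidth {m n : ℕ} (A : Matrix (Fin m) (Fin n) ℕ) : ℕ :=
  (columnMatroid (A.map (Nat.cast : ℕ → ℝ))).pathWidth

/-- The bit length of the largest entry of `A` and `b` (at least one). -/
def entryBits {m n : ℕ} (A : Matrix (Fin m) (Fin n) ℕ) (b : Fin m → ℕ) : ℕ :=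
  max 1 (Nat.size (max (Finset.univ.sup fun i => Finset.univ.sup fun j => A i j) (maxEntry b)))

/-- The input of an algorithm for integer programming: the numbers of rows and columns in registers
`0` and `1`, the matrix row by row in array `0`, and the right-hand side in array `1`. -/
def toInput {m n : ℕ} (A : Matrix (Fin m) (Fin n) ℕ) (b : Fin m → ℕ) : RAM.State :=
  RAM.input m n
    (fun i => if h : i / n < m ∧ i % n < n then A ⟨i / n, h.1⟩ ⟨i % n, h.2⟩ else 0)
    (fun i => if h : i < m then b ⟨i, h⟩ else 0)

end IP

/-! ### The rank function of a column matroid -/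

/-! An algorithm for (IP) that beats the bound would decide `q`-SAT in time `2^(c'n) m^O(1)` with
one constant `c' < 1` for all `q`, which contradicts SETH.

Fix a number `c` of blocks and split the `n` variables into `c` blocks of `L = n / c + 1` variables,
so that a block has `W = 2^L` values. For a formula with `M` clauses there is a slot for each pair
of a clause `i` and a block `j`, numbered `i * c + j`. Each slot has `W` selector variables and a
slack variable. The rows say that every slot selects one value, that the slots `p` and `p + c` (the
same block at consecutive clauses) select the same value, and that at each clause at most `c - 1` of
the blocks fail to satisfy it. Equality of values `φ = φ'` is written as `φ + (W - 1 - φ') = W - 1`,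
so no negative entry is needed (`feasible_ipMatrix_iff`, `exists_blocks_iff_satisfiable`).

All right-hand sides are at most `W + c`. In the order of the slots, a cut between columns is
crossed by one selection row, `c + 1` equality rows and one clause row. For column sets `X` and its
complement, `λ(X) - 1` is the dimension of the intersection of their spans, hence at most the number
of rows crossing the cut. A comb with the columns as leaves in this order therefore shows that the
path-width is at most `c + 4` (`pathWidth_columnMatroid_le`, `columnPathWidth_ipMatrix_le`).

With `γ = max 0 (1 - ε) < 1` the assumed algorithm needs time about `W^(γ (c + 4) + 2a)` up to
factors polynomial in `M`, and writing down the program costs about `W^2`. As `W` is about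
`2^(n/c)`, the exponent of `2` is `n (γ (c + 4) + 2a + 2) / c` up to a constant, which is at most `n
(1 + γ) / 2` once `c` is large. Since `c` does not depend on the formula, only finitely many values
of `f` matter. The reduction has to be an actual machine program with a time bound; a crude bound,
quadratic in a bound `V` for all numbers that occur, suffices (`reduceProg_runsTo`). The algorithm
for (IP) is then run on renamed, still untouched memory (`Exec.rename`). -/

theorem columnMatroid_ground {m n : ℕ} (A : Matrix (Fin m) (Fin n) ℝ) :
    (columnMatroid A).E = Set.univ := rfl

theorem columnMatroid_indep {m n : ℕ} (A : Matrix (Fin m) (Fin n) ℝ) (I : Set (Fin n)) :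
    (columnMatroid A).Indep I ↔ LinearIndepOn ℝ A.col I := by
  simp [columnMatroid]

/-- A basis of `X` is a maximal independent subset, so its columns span all columns of `X`. -/
theorem columnMatroid_toNat_eRk {m n : ℕ} (A : Matrix (Fin m) (Fin n) ℝ) (X : Set (Fin n)) :
    ((columnMatroid A).eRk X).toNat = Module.finrank ℝ (Submodule.span ℝ (A.col '' X)) := by
  classical
  obtain ⟨I, hI⟩ := (columnMatroid A).exists_isBasis X (by simp [columnMatroid_ground])
  have hli := (columnMatroid_indep A I).1 hI.indep
  have hspan : Submodule.span ℝ (A.col '' X) = Submodule.span ℝ (A.col '' I) := by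
    refine le_antisymm (Submodule.span_le.2 ?_)
      (Submodule.span_mono (Set.image_mono hI.subset))
    rintro _ ⟨e, he, rfl⟩
    by_contra hn
    have heI : e ∉ I := fun h => hn (Submodule.subset_span ⟨e, h, rfl⟩)
    have hins : (columnMatroid A).Indep (insert e I) :=
      (columnMatroid_indep A _).2 (hli.insert hn)
    exact heI (hI.eq_of_subset_indep hins (Set.subset_insert _ _)
      (Set.insert_subset he hI.subset) ▸ Set.mem_insert e I)
  have h := finrank_span_eq_card (R := ℝ) (b := fun i : I => A.col i) hli
  rw [hspan, Set.image_eq_range, h, ← hI.encard_eq_eRk, ← Set.toFinset_card,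
    ← Set.ncard_eq_toFinset_card']
  rfl

theorem finrank_le_card_of_support {m : ℕ} (S : Submodule ℝ (Fin m → ℝ)) (R : Finset (Fin m))
    (h : ∀ v ∈ S, ∀ r, r ∉ R → v r = 0) : Module.finrank ℝ S ≤ R.card := by
  classical
  have hle : S ≤ Submodule.span ℝ
      ((R.image fun r => (Pi.single r 1 : Fin m → ℝ) : Finset (Fin m → ℝ)) : Set (Fin m → ℝ)) := by
    intro v hv
    have hsum : v = ∑ r ∈ R, v r • (Pi.single r 1 : Fin m → ℝ) := by
      ext s
      simp only [Finset.sum_apply, Pi.smul_apply, Pi.single_apply, smul_eq_mul, mul_ite, mul_one,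
        mul_zero, Finset.sum_ite_eq]
      split_ifs with hs
      · rfl
      · exact h v hv s hs
    rw [hsum]
    refine Submodule.sum_mem _ fun r hr => Submodule.smul_mem _ _ (Submodule.subset_span ?_)
    simp only [Finset.coe_image, Set.mem_image, Finset.mem_coe]
    exact ⟨r, hr, rfl⟩
  exact (Submodule.finrank_mono hle).trans
    ((finrank_span_finset_le_card _).trans Finset.card_image_le)

theorem span_col_apply_eq_zero {m n : ℕ} (A : Matrix (Fin m) (Fin n) ℝ) (X : Set (Fin n))
    (r : Fin m) (h : ∀ x ∈ X, A r x = 0) (v : Fin m → ℝ)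
    (hv : v ∈ Submodule.span ℝ (A.col '' X)) : v r = 0 := by
  have hle : Submodule.span ℝ (A.col '' X) ≤ LinearMap.ker (LinearMap.proj (R := ℝ) r) := by
    rw [Submodule.span_le]
    rintro _ ⟨x, hx, rfl⟩
    simpa using h x hx
  simpa using hle hv

/-- The connectivity of a set of columns is at most one more than the number of rows that have
nonzero entries both inside and outside of the set. -/
theorem pwConnectivity_columnMatroid_le {m n : ℕ} (A : Matrix (Fin m) (Fin n) ℝ)
    (X : Set (Fin n)) (R : Finset (Fin m))
    (h : ∀ r, r ∉ R → (∀ x ∈ X, A r x = 0) ∨ (∀ x ∈ Xᶜ, A r x = 0)) :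
    (columnMatroid A).pwConnectivity X ≤ (R.card : ℤ) + 1 := by
  unfold Matroid.pwConnectivity
  rw [columnMatroid_toNat_eRk, columnMatroid_toNat_eRk, columnMatroid_toNat_eRk,
    columnMatroid_ground, ← Set.compl_eq_univ_sdiff]
  -- The modular law turns `λ(X) - 1` into the dimension of the intersection of the two spans; a
  -- vector in it vanishes at every row that is zero on one side.
  have h1 := Submodule.finrank_sup_add_finrank_inf_eq (Submodule.span ℝ (A.col '' X))
    (Submodule.span ℝ (A.col '' Xᶜ))
  rw [← Submodule.span_union, ← Set.image_union, Set.union_compl_self] at h1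
  have h2 := finrank_le_card_of_support
    (Submodule.span ℝ (A.col '' X) ⊓ Submodule.span ℝ (A.col '' Xᶜ)) R (by
      rintro v ⟨hv1, hv2⟩ r hr
      rcases h r hr with h | h
      · exact span_col_apply_eq_zero A X r h v hv1
      · exact span_col_apply_eq_zero A Xᶜ r h v hv2)
  omega

theorem pwConnectivity_compl {m n : ℕ} (A : Matrix (Fin m) (Fin n) ℝ) (X : Set (Fin n)) :
    (columnMatroid A).pwConnectivity Xᶜ = (columnMatroid A).pwConnectivity X := by
  unfold Matroid.pwConnectivity
  rw [columnMatroid_ground, ← Set.compl_eq_univ_sdiff, ← Set.compl_eq_univ_sdiff, compl_compl]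
  ring

theorem pwConnectivity_singleton_le {m n : ℕ} (A : Matrix (Fin m) (Fin n) ℝ) (x : Fin n) :
    (columnMatroid A).pwConnectivity {x} ≤ 2 := by
  unfold Matroid.pwConnectivity
  rw [columnMatroid_toNat_eRk, columnMatroid_toNat_eRk, columnMatroid_toNat_eRk,
    columnMatroid_ground]
  have h1 : Module.finrank ℝ (Submodule.span ℝ (A.col '' {x})) ≤ 1 := by
    rw [Set.image_singleton]
    exact (finrank_span_le_card _).trans (by simp)
  have h2 : Module.finrank ℝ (Submodule.span ℝ (A.col '' (Set.univ \ {x}))) ≤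
      Module.finrank ℝ (Submodule.span ℝ (A.col '' Set.univ)) :=
    Submodule.finrank_mono (Submodule.span_mono (Set.image_mono Set.sdiff_subset))
  omega

/-! ### Cuts of trees -/

/-- A walk that avoids the only edge leaving `S` never changes sides. -/
theorem mem_of_reachable_deleteEdges {V : Type*} {T : SimpleGraph V} {u v : V} {S : Set V}
    (hS : ∀ x y, T.Adj x y → x ∈ S → y ∉ S → s(x, y) = s(u, v)) {x y : V}
    (h : (T.deleteEdges {s(u, v)}).Reachable x y) : x ∈ S ↔ y ∈ S := by
  obtain ⟨p⟩ := h
  induction p with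
  | nil => rfl
  | cons hadj _ ih =>
    rw [← ih]
    rw [SimpleGraph.deleteEdges_adj, Set.mem_singleton_iff] at hadj
    constructor
    · intro hx
      by_contra hy
      exact hadj.2 (hS _ _ hadj.1 hx hy)
    · intro hy
      by_contra hx
      exact hadj.2 (Sym2.eq_swap.trans (hS _ _ hadj.1.symm hy hx))

/-- A walk from `x` to `u`, stopped before it first uses the edge `uv`, ends in `u` or in `v`. -/
theorem reachable_deleteEdges_or {V : Type*} {T : SimpleGraph V} {u v x : V}
    (h : T.Reachable u x) :
    (T.deleteEdges {s(u, v)}).Reachable u x ∨ (T.deleteEdges {s(u, v)}).Reachable v x := by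
  obtain ⟨p⟩ := h.symm
  have key : ∀ {a b : V} (p : T.Walk a b), b = u →
      (T.deleteEdges {s(u, v)}).Reachable u a ∨ (T.deleteEdges {s(u, v)}).Reachable v a := by
    intro a b p
    induction p with
    | nil => rintro rfl; exact Or.inl (SimpleGraph.Reachable.refl _)
    | @cons a b c hadj _ ih =>
      intro hc
      by_cases he : s(a, b) = s(u, v)
      · rcases Sym2.eq_iff.1 he with ⟨rfl, -⟩ | ⟨rfl, -⟩
        · exact Or.inl (SimpleGraph.Reachable.refl _)
        · exact Or.inr (SimpleGraph.Reachable.refl _)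
      · have hab : (T.deleteEdges {s(u, v)}).Adj b a := by
          rw [SimpleGraph.deleteEdges_adj, Set.mem_singleton_iff]
          exact ⟨hadj.symm, fun h => he (Sym2.eq_swap.trans h)⟩
        exact (ih hc).imp (fun h => h.trans hab.reachable) (fun h => h.trans hab.reachable)
  exact key p rfl

/-- If every edge `uv` of a connected graph is the only one that leaves some set containing `u`
but not `v`, then the graph is a tree. -/
theorem isTree_of_cuts {V : Type*} {T : SimpleGraph V} (hT : T.Connected)
    (S : V → V → Set V) (hu : ∀ u v, T.Adj u v → u ∈ S u v) (hv : ∀ u v, T.Adj u v → v ∉ S u v)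
    (hS : ∀ u v, T.Adj u v → ∀ x y, T.Adj x y → x ∈ S u v → y ∉ S u v → s(x, y) = s(u, v)) :
    T.IsTree := by
  refine ⟨hT, SimpleGraph.isAcyclic_iff_forall_adj_isBridge.2 fun u v huv => ?_⟩
  rw [SimpleGraph.isBridge_iff]
  intro h
  exact hv u v huv ((mem_of_reachable_deleteEdges (hS u v huv) h).1 (hu u v huv))

/-- This identifies the component that enters the width of an edge with an explicit set. -/
theorem reachable_deleteEdges_iff {V : Type*} {T : SimpleGraph V} (hT : T.Connected)
    {u v : V} {S : Set V} (hu : u ∈ S) (hv : v ∉ S)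
    (hS : ∀ x y, T.Adj x y → x ∈ S → y ∉ S → s(x, y) = s(u, v)) (x : V) :
    (T.deleteEdges {s(u, v)}).Reachable u x ↔ x ∈ S := by
  constructor
  · intro h
    exact (mem_of_reachable_deleteEdges hS h).1 hu
  · intro hx
    rcases reachable_deleteEdges_or (v := v) (hT.preconnected u x) with h | h
    · exact h
    · exact absurd ((mem_of_reachable_deleteEdges hS h).2 hx) hv

/-! ### The comb: a path with a pendant vertex at every inner vertex -/

/-- The vertices of the comb: `(i, false)` are the vertices of the path, and `(i, true)` are the
pendant vertices. -/
abbrev CombVertex (n : ℕ) : Type :=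
  {v : ℕ × Bool // v.1 < n ∧ (v.2 = true → 0 < v.1 ∧ v.1 + 1 < n)}

theorem combVertex_finite (n : ℕ) : Finite (CombVertex n) := by
  have : Set.Finite {v : ℕ × Bool | v.1 < n ∧ (v.2 = true → 0 < v.1 ∧ v.1 + 1 < n)} := by
    refine ((Set.finite_Iio n).prod (Set.finite_univ (α := Bool))).subset ?_
    rintro ⟨i, b⟩ h
    exact ⟨h.1, trivial⟩
  exact this.to_subtype

/-- The comb. -/
def combGraph (n : ℕ) : SimpleGraph (CombVertex n) where
  Adj u v := (u.1.2 = false ∧ v.1.2 = false ∧ (u.1.1 + 1 = v.1.1 ∨ v.1.1 + 1 = u.1.1)) ∨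
    (u.1.1 = v.1.1 ∧ u.1.2 ≠ v.1.2)
  symm := ⟨by
    rintro u v (⟨h1, h2, h3⟩ | ⟨h1, h2⟩)
    · exact Or.inl ⟨h2, h1, h3.symm⟩
    · exact Or.inr ⟨h1.symm, h2.symm⟩⟩
  loopless := ⟨by
    rintro u (⟨-, -, h⟩ | ⟨-, h⟩)
    · omega
    · exact h rfl⟩

/-- The vertex of the path with index `i`. -/
def combSpine {n : ℕ} (i : ℕ) (hi : i < n) : CombVertex n := ⟨(i, false), hi, by simp⟩

/-- All `k` are needed for connectedness; `k = n - 1` is the path of the caterpillar. -/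
theorem combGraph_exists_path {n : ℕ} (k : ℕ) (hk : k < n) :
    ∃ p : (combGraph n).Walk (combSpine 0 (by omega)) (combSpine k hk), p.IsPath ∧
      ∀ w, w ∈ p.support ↔ w.1.2 = false ∧ w.1.1 ≤ k := by
  induction k with
  | zero =>
    refine ⟨.nil, .nil, fun w => ?_⟩
    rw [SimpleGraph.Walk.support_nil, List.mem_singleton, Subtype.ext_iff, Prod.ext_iff]
    simp only [combSpine, Nat.le_zero]
    exact and_comm
  | succ k ih =>
    obtain ⟨p, hp, hsupp⟩ := ih (by omega)
    have hadj : (combGraph n).Adj (combSpine k (by omega)) (combSpine (k + 1) hk) :=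
      Or.inl ⟨rfl, rfl, Or.inl rfl⟩
    refine ⟨p.concat hadj, hp.concat ?_ hadj, fun w => ?_⟩
    · rw [hsupp]
      simp [combSpine]
    · rw [SimpleGraph.Walk.support_concat, List.mem_append, hsupp,
        List.mem_singleton, Subtype.ext_iff, Prod.ext_iff]
      simp only [combSpine]
      constructor
      · rintro (h | h)
        · exact ⟨h.1, by omega⟩
        · exact ⟨h.2, by omega⟩
      · rintro ⟨h1, h2⟩
        by_cases h : w.1.1 ≤ k
        · exact Or.inl ⟨h1, h⟩
        · exact Or.inr ⟨by omega, h1⟩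

theorem combGraph_connected {n : ℕ} (hn : 0 < n) : (combGraph n).Connected := by
  have key : ∀ v : CombVertex n, (combGraph n).Reachable (combSpine 0 hn) v := by
    rintro ⟨⟨i, b⟩, hi, hb⟩
    obtain ⟨p, -⟩ := combGraph_exists_path i hi
    cases b with
    | false => exact ⟨p⟩
    | true =>
      have hadj : (combGraph n).Adj (combSpine i hi) ⟨(i, true), hi, hb⟩ :=
        Or.inr ⟨rfl, by simp [combSpine]⟩
      exact ⟨p.concat hadj⟩
  have : Nonempty (CombVertex n) := ⟨combSpine 0 hn⟩
  exact ⟨fun u v => (key u).symm.trans (key v)⟩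

/-- The side of `u` of the edge `uv` of the comb. -/
def combCut {n : ℕ} (u v : CombVertex n) : Set (CombVertex n) :=
  if u.1.2 = true then {u}
  else if v.1.2 = true then {v}ᶜ
  else if u.1.1 < v.1.1 then {w | w.1.1 ≤ u.1.1}
  else {w | w.1.1 ≤ v.1.1}ᶜ

theorem combCut_left {n : ℕ} {u v : CombVertex n} (h : (combGraph n).Adj u v) :
    u ∈ combCut u v := by
  obtain ⟨⟨i, b⟩, hu⟩ := u
  obtain ⟨⟨j, d⟩, hv⟩ := v
  simp only [combGraph] at h
  cases b <;> cases d <;> simp_all [combCut]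
  split_ifs
  · simp
  · simp; omega

theorem combCut_right {n : ℕ} {u v : CombVertex n} (h : (combGraph n).Adj u v) :
    v ∉ combCut u v := by
  obtain ⟨⟨i, b⟩, hu⟩ := u
  obtain ⟨⟨j, d⟩, hv⟩ := v
  simp only [combGraph] at h
  cases b <;> cases d <;> simp_all [combCut]
  split_ifs
  · simp; omega
  · simp

/-- Pendant edges preserve the index, so a cut by index is crossed only by the edge between two
consecutive path vertices; a cut that isolates a pendant vertex is crossed only by its own edge. -/
theorem combCut_edge {n : ℕ} {u v : CombVertex n} (h : (combGraph n).Adj u v)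
    (x y : CombVertex n) (hxy : (combGraph n).Adj x y) (hx : x ∈ combCut u v)
    (hy : y ∉ combCut u v) : s(x, y) = s(u, v) := by
  obtain ⟨⟨i, b⟩, hu⟩ := u
  obtain ⟨⟨j, d⟩, hv⟩ := v
  obtain ⟨⟨k, e⟩, hx'⟩ := x
  obtain ⟨⟨l, f⟩, hy'⟩ := y
  rw [Sym2.eq_iff]
  simp only [combGraph] at h hxy
  simp only [combCut] at hx hy
  simp only [Subtype.mk.injEq, Prod.mk.injEq]
  cases b <;> cases d <;> simp at h hx hy
  · split_ifs at hx hy with hij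
    · simp at hx hy
      cases e <;> cases f <;> simp at hxy ⊢ <;> omega
    · simp at hx hy
      cases e <;> cases f <;> simp at hxy ⊢ <;> omega
  · cases e <;> cases f <;> (simp at hxy hx hy ⊢; try omega)
  · cases e <;> cases f <;> (simp at hxy hx hy ⊢; try omega)

theorem combGraph_isTree {n : ℕ} (hn : 0 < n) : (combGraph n).IsTree :=
  isTree_of_cuts (combGraph_connected hn) combCut (fun _ _ => combCut_left)
    (fun _ _ => combCut_right) (fun _ _ => combCut_edge)

theorem combGraph_neighborSet_pendant {n : ℕ} (i : ℕ) (h : 0 < i ∧ i + 1 < n) :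
    (combGraph n).neighborSet ⟨(i, true), by omega, fun _ => h⟩ = {combSpine i (by omega)} := by
  ext ⟨⟨j, b⟩, hj⟩
  cases b
  · simpa [combGraph, combSpine] using eq_comm
  · simp [combGraph, combSpine]

theorem combGraph_ncard_neighborSet {n : ℕ} (i : ℕ) (h : 0 < i ∧ i + 1 < n) :
    ((combGraph n).neighborSet (combSpine i (by omega))).ncard = 3 := by
  have : (combGraph n).neighborSet (combSpine i (by omega)) =
      {combSpine (i - 1) (by omega), combSpine (i + 1) (by omega),
        ⟨(i, true), by omega, fun _ => h⟩} := by
    ext ⟨⟨j, b⟩, hj⟩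
    cases b <;> simp [combGraph, combSpine] <;> omega
  rw [this, Set.ncard_eq_three]
  refine ⟨_, _, _, ?_, ?_, ?_, rfl⟩ <;> simp [combSpine]

theorem combGraph_isTreeLeaf_pendant {n : ℕ} (i : ℕ) (h : 0 < i ∧ i + 1 < n) :
    IsTreeLeaf (combGraph n) ⟨(i, true), by omega, fun _ => h⟩ := by
  unfold IsTreeLeaf
  rw [combGraph_neighborSet_pendant i h, Set.ncard_singleton]

/-- The ends of the path carry no pendant vertex and are leaves themselves. This makes `n` leaves in
total, also for `n = 1` and `n = 2`. -/
theorem combGraph_isTreeLeaf_spine {n : ℕ} (i : ℕ) (hi : i < n) :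
    IsTreeLeaf (combGraph n) (combSpine i hi) ↔ ¬ (0 < i ∧ i + 1 < n) := by
  refine ⟨fun hl h => ?_, fun h => ?_⟩
  · have := combGraph_ncard_neighborSet i h
    unfold IsTreeLeaf at hl
    omega
  · unfold IsTreeLeaf
    have := combVertex_finite n
    rw [Set.ncard_le_one_iff_subsingleton]
    rintro ⟨⟨j, b⟩, hj⟩ hu ⟨⟨k, d⟩, hk⟩ hv
    have hb : b = true → 0 < j ∧ j + 1 < n := hj.2
    have hd : d = true → 0 < k ∧ k + 1 < n := hk.2
    cases b <;> cases d <;> simp [combGraph, combSpine] at hu hv hb hd ⊢ <;> omega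

theorem combGraph_isCubicTree {n : ℕ} (hn : 0 < n) : IsCubicTree (combGraph n) := by
  refine ⟨combGraph_isTree hn, ?_⟩
  rintro ⟨⟨i, b⟩, hi, hb⟩ hl
  cases b with
  | true => exact absurd (combGraph_isTreeLeaf_pendant i (hb rfl)) hl
  | false =>
    refine combGraph_ncard_neighborSet i ?_
    by_contra h
    exact hl ((combGraph_isTreeLeaf_spine i hi).2 h)

theorem combGraph_isCaterpillar {n : ℕ} (hn : 0 < n) : IsCaterpillar (combGraph n) := by
  obtain ⟨p, hp, hsupp⟩ := combGraph_exists_path (n - 1) (show n - 1 < n by omega)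
  refine ⟨combGraph_isTree hn, _, _, p, hp, ?_⟩
  rintro ⟨⟨i, b⟩, hi, hb⟩ hw
  rw [hsupp] at hw
  cases b with
  | false => exact absurd ⟨rfl, by simp only; omega⟩ hw
  | true =>
    exact ⟨combSpine i hi, (hsupp _).2 ⟨rfl, by simp only [combSpine]; omega⟩,
      combGraph_neighborSet_pendant i (hb rfl)⟩

/-- The leaf of the comb with index `i`. -/
def combLeaf {n : ℕ} (i : Fin n) : CombVertex n :=
  if h : 0 < i.1 ∧ i.1 + 1 < n then ⟨(i, true), i.2, fun _ => h⟩ else combSpine i i.2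

theorem combLeaf_fst {n : ℕ} (i : Fin n) : (combLeaf i).1.1 = i := by
  unfold combLeaf
  split_ifs <;> rfl

theorem combLeaf_bijOn (n : ℕ) :
    Set.BijOn (combLeaf (n := n)) Set.univ {v | IsTreeLeaf (combGraph n) v} := by
  refine ⟨fun i _ => ?_, fun i _ j _ h => ?_, ?_⟩
  · unfold combLeaf
    split_ifs with h
    · exact combGraph_isTreeLeaf_pendant _ h
    · exact (combGraph_isTreeLeaf_spine _ _).2 h
  · have := congrArg (fun v => v.1.1) h
    simp only [combLeaf_fst] at this
    exact Fin.ext this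
  · rintro ⟨⟨i, b⟩, hi, hb⟩ hv
    refine ⟨⟨i, hi⟩, trivial, ?_⟩
    cases b with
    | true => simp [combLeaf, hb rfl]
    | false =>
      have := (combGraph_isTreeLeaf_spine i hi).1 hv
      simp only [combLeaf, this, dite_false]
      rfl

/-- If at every cut between consecutive columns at most `w` rows have nonzero entries on both
sides, then the path-width of the column matroid is at most `w + 1`. -/
theorem pathWidth_columnMatroid_le {m n : ℕ} (A : Matrix (Fin m) (Fin n) ℝ) (hn : 0 < n)
    (w : ℕ) (hw : 1 ≤ w)
    (h : ∀ t : ℕ, ∃ R : Finset (Fin m), R.card ≤ w ∧ ∀ r, r ∉ R →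
      (∀ x : Fin n, x.1 ≤ t → A r x = 0) ∨ (∀ x : Fin n, t < x.1 → A r x = 0)) :
    (columnMatroid A).pathWidth ≤ w + 1 := by
  refine Nat.sInf_le ⟨CombVertex n, combVertex_finite n, combGraph n, combLeaf,
    ⟨combGraph_isCubicTree hn, combLeaf_bijOn n⟩, combGraph_isCaterpillar hn, ?_⟩
  intro u v huv
  have hset : {x ∈ (columnMatroid A).E |
      ((combGraph n).deleteEdges {s(u, v)}).Reachable u (combLeaf x)} =
      {x | combLeaf x ∈ combCut u v} := by
    ext x
    rw [columnMatroid_ground]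
    simp only [Set.mem_univ, true_and, Set.mem_ofPred_eq]
    exact reachable_deleteEdges_iff (combGraph_connected hn) (combCut_left huv)
      (combCut_right huv) (combCut_edge huv) _
  rw [hset]
  have hcut : ∀ t : ℕ, (columnMatroid A).pwConnectivity {x | x.1 ≤ t} ≤ ((w + 1 : ℕ) : ℤ) := by
    intro t
    obtain ⟨R, hR, hrow⟩ := h t
    have := pwConnectivity_columnMatroid_le A {x | x.1 ≤ t} R fun r hr =>
      (hrow r hr).imp id fun h x hx => h x (by simpa using hx)
    push_cast
    omega
  have hleaf : ∀ a : CombVertex n, a.1.2 = true →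
      {x : Fin n | combLeaf x = a} = {⟨a.1.1, a.2.1⟩} := by
    rintro ⟨⟨i, b⟩, hi, hb⟩ rfl
    ext x
    simp only [Set.mem_ofPred_eq, Set.mem_singleton_iff]
    constructor
    · intro hx
      have := congrArg (fun v => v.1.1) hx
      simp only [combLeaf_fst] at this
      exact Fin.ext this
    · rintro rfl
      simp [combLeaf, hb rfl]
  unfold combCut
  split_ifs with h1 h2 h3
  -- An edge at a pendant vertex separates one column, with connectivity at most `2 ≤ w + 1`; here
  -- `1 ≤ w` is needed.
  · simp only [Set.mem_singleton_iff]
    rw [hleaf u h1]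
    have := pwConnectivity_singleton_le A ⟨u.1.1, u.2.1⟩
    push_cast
    omega
  · have : {x : Fin n | combLeaf x ∈ ({v} : Set (CombVertex n))ᶜ} = {x | combLeaf x = v}ᶜ := rfl
    rw [this, hleaf v h2, pwConnectivity_compl]
    have := pwConnectivity_singleton_le A ⟨v.1.1, v.2.1⟩
    push_cast
    omega
  · simp only [Set.mem_ofPred_eq, combLeaf_fst]
    exact hcut _
  · have : {x : Fin n | combLeaf x ∈ {w : CombVertex n | w.1.1 ≤ v.1.1}ᶜ} =
        {x : Fin n | x.1 ≤ v.1.1}ᶜ := by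
      ext x
      simp [combLeaf_fst]
    rw [this, pwConnectivity_compl]
    exact hcut _

/-! ### The integer program -/

theorem sum_range_mul_eq (S B : ℕ) (G : ℕ → ℕ) :
    ∑ k ∈ Finset.range (S * B), G k =
      ∑ p ∈ Finset.range S, ∑ φ ∈ Finset.range B, G (p * B + φ) := by
  induction S with
  | zero => simp
  | succ S ih => rw [Nat.succ_mul, Finset.sum_range_add, ih, Finset.sum_range_succ]

theorem mul_add_div_of_lt {p B φ : ℕ} (h : φ < B) : (p * B + φ) / B = p := by
  rw [Nat.add_comm, Nat.add_mul_div_right _ _ (by omega), Nat.div_eq_of_lt h, Nat.zero_add]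

theorem mul_add_mod_of_lt {p B φ : ℕ} (h : φ < B) : (p * B + φ) % B = φ := by
  rw [Nat.add_comm, Nat.add_mul_mod_self_right, Nat.mod_eq_of_lt h]

/-- The coefficient in the row `(τ, p)` of the variable `(p', φ)`. The slot `p' = i * c + j` belongs
to the clause `i` and the block `j`. The variable with `φ < W` selects the value `φ` at the slot,
the variable with `φ = W` is a slack variable. The rows with `τ = 0` demand that one value is
selected, those with `τ = 1` that block `j` has the same value at slots `p` and `p + c`, and those
with `τ = 2` that not all `c` values satisfy `u = 1` at clause `p`. -/
def slotEntry (c M W : ℕ) (u : ℕ → ℕ → ℕ → ℕ) (τ p p' φ : ℕ) : ℕ :=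
  if τ = 0 then (if p' = p ∧ φ < W then 1 else 0)
  else if τ = 1 then
    (if φ < W ∧ p + c < M * c then
      (if p' = p then φ else if p' = p + c then W - 1 - φ else 0) else 0)
  else (if p' / c = p then (if φ < W then u p (p' % c) φ else 1) else 0)

/-- The right-hand side of the row `(τ, p)`. -/
def slotRhs (c M W τ p : ℕ) : ℕ :=
  if τ = 0 then 1
  else if τ = 1 then (if p + c < M * c then W - 1 else 0)
  else (if p < M then c - 1 else 0)

/-- The matrix entries, with rows and columns numbered consecutively. -/
def ipEntry (c M W : ℕ) (u : ℕ → ℕ → ℕ → ℕ) (r k : ℕ) : ℕ :=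
  slotEntry c M W u (r / (M * c)) (r % (M * c)) (k / (W + 1)) (k % (W + 1))

/-- The right-hand side, with rows numbered consecutively. -/
def ipRhs (c M W r : ℕ) : ℕ :=
  slotRhs c M W (r / (M * c)) (r % (M * c))

/-- The constraint matrix. -/
def ipMatrix (c M W : ℕ) (u : ℕ → ℕ → ℕ → ℕ) :
    Matrix (Fin (3 * (M * c))) (Fin (M * c * (W + 1))) ℕ :=
  fun r k => ipEntry c M W u r k

/-- The vector of the right-hand sides. -/
def ipVector (c M W : ℕ) : Fin (3 * (M * c)) → ℕ :=
  fun r => ipRhs c M W r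

/-- Division with remainder converts between the consecutive numbering and the pairs `(τ, p)` of
rows and `(p', φ)` of columns. -/
theorem feasible_ipMatrix_iff_slots (c M W : ℕ) (u : ℕ → ℕ → ℕ → ℕ) :
    IP.Feasible (ipMatrix c M W u) (ipVector c M W) ↔
      ∃ Y : ℕ → ℕ → ℕ, ∀ τ < 3, ∀ p < M * c,
        ∑ p' ∈ Finset.range (M * c), ∑ φ ∈ Finset.range (W + 1),
          slotEntry c M W u τ p p' φ * Y p' φ = slotRhs c M W τ p := by
  have key : ∀ (X : ℕ → ℕ) (τ p : ℕ), p < M * c →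
      ∑ k : Fin (M * c * (W + 1)), ipEntry c M W u (τ * (M * c) + p) k * X k =
      ∑ p' ∈ Finset.range (M * c), ∑ φ ∈ Finset.range (W + 1),
          slotEntry c M W u τ p p' φ * X (p' * (W + 1) + φ) := by
    intro X τ p hp
    rw [Fin.sum_univ_eq_sum_range (fun k => ipEntry c M W u (τ * (M * c) + p) k * X k),
      sum_range_mul_eq]
    refine Finset.sum_congr rfl fun p' _ => Finset.sum_congr rfl fun φ hφ => ?_
    rw [Finset.mem_range] at hφ
    simp only [ipEntry, mul_add_div_of_lt hp, mul_add_mod_of_lt hp, mul_add_div_of_lt hφ,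
      mul_add_mod_of_lt hφ]
  constructor
  · rintro ⟨x, hx⟩
    refine ⟨fun p φ => if h : p * (W + 1) + φ < M * c * (W + 1) then x ⟨_, h⟩ else 0, ?_⟩
    intro τ hτ p hp
    have hr : τ * (M * c) + p < 3 * (M * c) := by nlinarith
    have hrow := congrFun hx ⟨_, hr⟩
    have hk := key (fun k => if h : k < M * c * (W + 1) then x ⟨k, h⟩ else 0) τ p hp
    simp only [Fin.is_lt, dite_true, Fin.eta] at hk
    rw [← hk]
    simp only [ipVector, ipRhs, mul_add_div_of_lt hp, mul_add_mod_of_lt hp] at hrow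
    exact hrow
  · rintro ⟨Y, hY⟩
    refine ⟨fun k => Y (k / (W + 1)) (k % (W + 1)), ?_⟩
    ext ⟨r, hr⟩
    have hs : 0 < M * c := by
      by_contra h
      have : M * c = 0 := by omega
      rw [this] at hr
      omega
    have hp : r % (M * c) < M * c := Nat.mod_lt _ hs
    have hτ : r / (M * c) < 3 := Nat.div_lt_of_lt_mul (by rwa [mul_comm])
    have hk := key (fun k => Y (k / (W + 1)) (k % (W + 1))) (r / (M * c)) _ hp
    rw [Nat.div_add_mod'] at hk
    change ∑ k : Fin (M * c * (W + 1)),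
      ipEntry c M W u r k * Y (k / (W + 1)) (k % (W + 1)) = ipRhs c M W r
    rw [hk, ipRhs, ← hY _ hτ _ hp]
    refine Finset.sum_congr rfl fun p' _ => Finset.sum_congr rfl fun φ hφ => ?_
    rw [Finset.mem_range] at hφ
    rw [mul_add_div_of_lt hφ, mul_add_mod_of_lt hφ]

theorem sum_slotEntry_zero {c M W : ℕ} (u : ℕ → ℕ → ℕ → ℕ) (Y : ℕ → ℕ → ℕ) {p : ℕ}
    (hp : p < M * c) :
    ∑ p' ∈ Finset.range (M * c), ∑ φ ∈ Finset.range (W + 1),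
      slotEntry c M W u 0 p p' φ * Y p' φ = ∑ φ ∈ Finset.range W, Y p φ := by
  rw [Finset.sum_eq_single p]
  · rw [Finset.sum_range_succ]
    simp only [slotEntry, if_true, lt_irrefl, and_false, if_false, zero_mul, add_zero, true_and]
    refine Finset.sum_congr rfl fun φ hφ => ?_
    rw [if_pos (Finset.mem_range.1 hφ), one_mul]
  · intro p' _ hne
    simp [slotEntry, hne]
  · intro h
    exact absurd (Finset.mem_range.2 hp) h

theorem sum_slotEntry_one {c M W : ℕ} (hc : 0 < c) (u : ℕ → ℕ → ℕ → ℕ) (Y : ℕ → ℕ → ℕ) {p : ℕ}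
    (hp : p + c < M * c) :
    ∑ p' ∈ Finset.range (M * c), ∑ φ ∈ Finset.range (W + 1),
      slotEntry c M W u 1 p p' φ * Y p' φ =
      ∑ φ ∈ Finset.range W, φ * Y p φ +
        ∑ φ ∈ Finset.range W, (W - 1 - φ) * Y (p + c) φ := by
  rw [Finset.sum_eq_add p (p + c) (by omega)]
  · rw [Finset.sum_range_succ, Finset.sum_range_succ]
    congr 1
    · simp only [slotEntry, lt_irrefl, if_false, zero_mul, add_zero, one_ne_zero, if_true, hp,
        and_true]
      refine Finset.sum_congr rfl fun φ hφ => ?_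
      rw [if_pos (Finset.mem_range.1 hφ)]
    · simp only [slotEntry, lt_irrefl, false_and, if_false, zero_mul, add_zero, one_ne_zero,
        if_true, hp, and_true, show p + c ≠ p by omega]
      refine Finset.sum_congr rfl fun φ hφ => ?_
      rw [if_pos (Finset.mem_range.1 hφ)]
  · intro p' _ hne
    simp [slotEntry, hne.1, hne.2]
  · intro h
    exact absurd (Finset.mem_range.2 (by omega)) h
  · intro h
    exact absurd (Finset.mem_range.2 hp) h

theorem sum_slotEntry_two {c M W : ℕ} (u : ℕ → ℕ → ℕ → ℕ) (Y : ℕ → ℕ → ℕ) {i : ℕ}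
    (hi : i < M) :
    ∑ p' ∈ Finset.range (M * c), ∑ φ ∈ Finset.range (W + 1),
      slotEntry c M W u 2 i p' φ * Y p' φ =
      ∑ j ∈ Finset.range c, (∑ φ ∈ Finset.range W, u i j φ * Y (i * c + j) φ +
        Y (i * c + j) W) := by
  rw [sum_range_mul_eq M c fun p' => ∑ φ ∈ Finset.range (W + 1),
      slotEntry c M W u 2 i p' φ * Y p' φ, Finset.sum_eq_single i]
  · refine Finset.sum_congr rfl fun j hj => ?_
    rw [Finset.mem_range] at hj
    rw [Finset.sum_range_succ]
    simp only [slotEntry, mul_add_div_of_lt hj, mul_add_mod_of_lt hj, OfNat.ofNat_ne_zero,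
      OfNat.ofNat_ne_one, if_false, if_true, lt_irrefl, one_mul]
    congr 1
    refine Finset.sum_congr rfl fun φ hφ => ?_
    rw [if_pos (Finset.mem_range.1 hφ)]
  · intro i' _ hne
    refine Finset.sum_eq_zero fun j hj => ?_
    rw [Finset.mem_range] at hj
    simp [slotEntry, mul_add_div_of_lt hj, hne]
  · intro h
    exact absurd (Finset.mem_range.2 hi) h

theorem sum_slotEntry_one_of_le {c M W : ℕ} (u : ℕ → ℕ → ℕ → ℕ) (Y : ℕ → ℕ → ℕ) {p : ℕ}
    (hp : ¬ p + c < M * c) :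
    ∑ p' ∈ Finset.range (M * c), ∑ φ ∈ Finset.range (W + 1),
      slotEntry c M W u 1 p p' φ * Y p' φ = 0 := by
  refine Finset.sum_eq_zero fun p' _ => Finset.sum_eq_zero fun φ _ => ?_
  simp [slotEntry, hp]

theorem sum_slotEntry_two_of_le {c M W : ℕ} (u : ℕ → ℕ → ℕ → ℕ) (Y : ℕ → ℕ → ℕ) {i : ℕ}
    (hi : ¬ i < M) :
    ∑ p' ∈ Finset.range (M * c), ∑ φ ∈ Finset.range (W + 1),
      slotEntry c M W u 2 i p' φ * Y p' φ = 0 := by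
  refine Finset.sum_eq_zero fun p' hp' => Finset.sum_eq_zero fun φ _ => ?_
  have : p' / c ≠ i := by
    have := Nat.div_lt_of_lt_mul (m := p') (n := c) (k := M)
      (by rw [mul_comm]; exact Finset.mem_range.1 hp')
    omega
  simp [slotEntry, this]

/-- Natural numbers with sum one form an indicator vector, so every linear form in them is
evaluation at the selected index. -/
theorem exists_selected_of_sum_eq_one {W : ℕ} {y : ℕ → ℕ} (h : ∑ φ ∈ Finset.range W, y φ = 1) :
    ∃ φ₀ < W, ∀ F : ℕ → ℕ, ∑ φ ∈ Finset.range W, F φ * y φ = F φ₀ := by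
  obtain ⟨φ₀, hφ₀, h1, h2⟩ : ∃ φ₀ ∈ Finset.range W, y φ₀ = 1 ∧
      ∀ φ ∈ Finset.range W, φ ≠ φ₀ → y φ = 0 := by
    obtain ⟨φ₀, hφ₀, hne⟩ : ∃ φ₀ ∈ Finset.range W, y φ₀ ≠ 0 := by
      by_contra! hcon
      rw [Finset.sum_eq_zero hcon] at h
      omega
    have hsplit := Finset.add_sum_erase _ y hφ₀
    refine ⟨φ₀, hφ₀, by omega, fun φ hφ hn => ?_⟩
    have := Finset.single_le_sum (f := y) (fun _ _ => Nat.zero_le _)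
      (Finset.mem_erase.2 ⟨hn, hφ⟩)
    omega
  refine ⟨φ₀, Finset.mem_range.1 hφ₀, fun F => ?_⟩
  rw [Finset.sum_eq_single_of_mem φ₀ hφ₀ fun φ hφ hn => by rw [h2 φ hφ hn, mul_zero], h1, mul_one]

theorem sum_selected {W : ℕ} {φ₀ : ℕ} (h : φ₀ < W) (F : ℕ → ℕ) :
    ∑ φ ∈ Finset.range W, F φ * (if φ = φ₀ then 1 else 0) = F φ₀ := by
  simp [h]

/-- The integer program is feasible exactly if values of the blocks can be chosen such that for
every clause the value of some block gives `u = 0`. -/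
theorem feasible_ipMatrix_iff {c M W : ℕ} (hc : 0 < c) (hM : 0 < M)
    (u : ℕ → ℕ → ℕ → ℕ) (hu : ∀ i j φ, u i j φ ≤ 1) :
    IP.Feasible (ipMatrix c M W u) (ipVector c M W) ↔
      ∃ g : ℕ → ℕ, (∀ j < c, g j < W) ∧ ∀ i < M, ∃ j < c, u i j (g j) = 0 := by
  rw [feasible_ipMatrix_iff_slots]
  constructor
  · rintro ⟨Y, hY⟩
    have h0 : ∀ p, ∃ φ₀, p < M * c → φ₀ < W ∧
        ∀ F : ℕ → ℕ, ∑ φ ∈ Finset.range W, F φ * Y p φ = F φ₀ := by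
      intro p
      by_cases hp : p < M * c
      · have := hY 0 (by omega) p hp
        rw [sum_slotEntry_zero u Y hp] at this
        obtain ⟨φ₀, h1, h2⟩ := exists_selected_of_sum_eq_one this
        exact ⟨φ₀, fun _ => ⟨h1, h2⟩⟩
      · exact ⟨0, fun h => absurd h hp⟩
    choose g hg using h0
    -- The row reads `g p + (W - 1 - g (p + c)) = W - 1`, and the subtraction is exact because
    -- selected values are below `W`.
    have hstep : ∀ p, p + c < M * c → g (p + c) = g p := by
      intro p hp
      have := hY 1 (by omega) p (by omega)
      rw [sum_slotEntry_one hc u Y hp, (hg p (by omega)).2 fun φ => φ,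
        (hg (p + c) hp).2 fun φ => W - 1 - φ] at this
      simp only [slotRhs, one_ne_zero, if_false, if_true, hp] at this
      have := (hg p (by omega)).1
      have := (hg (p + c) hp).1
      omega
    have hslot : ∀ i j, i < M → j < c → i * c + j < M * c := by
      intro i j hi hj
      nlinarith
    have hconst : ∀ i j, i < M → j < c → g (i * c + j) = g j := by
      intro i j hi hj
      induction i with
      | zero => simp
      | succ i ih =>
        have := hslot (i + 1) j hi hj
        rw [Nat.succ_mul, Nat.add_right_comm] at this ⊢
        rw [hstep _ this, ih (by omega)]
    refine ⟨g, fun j hj => (hg j (by nlinarith)).1, fun i hi => ?_⟩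
    by_contra! hcon
    have := hY 2 (by omega) i (by nlinarith)
    rw [sum_slotEntry_two u Y hi] at this
    simp only [slotRhs, OfNat.ofNat_ne_zero, OfNat.ofNat_ne_one, if_false, if_true, hi] at this
    -- If every block failed at clause `i`, the left-hand side would be at least `c`, since the
    -- slack variables are non-negative.
    have hge : ∑ j ∈ Finset.range c, 1 ≤ c - 1 := by
      rw [← this]
      refine Finset.sum_le_sum fun j hj => ?_
      rw [Finset.mem_range] at hj
      rw [(hg _ (hslot i j hi hj)).2 fun φ => u i j φ, hconst i j hi hj]
      have := hcon j hj
      omega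
    simp at hge
    omega
  · rintro ⟨g, hg, hsat⟩
    -- Selectors are indicators of the chosen values; the whole slack of a clause is put on its
    -- block `0`.
    let Y : ℕ → ℕ → ℕ := fun p φ =>
      if φ < W then (if φ = g (p % c) then 1 else 0)
      else if p % c = 0 then c - 1 - ∑ j ∈ Finset.range c, u (p / c) j (g j) else 0
    have hsum : ∀ p (F : ℕ → ℕ), ∑ φ ∈ Finset.range W, F φ * Y p φ = F (g (p % c)) := by
      intro p F
      rw [← sum_selected (hg _ (Nat.mod_lt p hc)) F]
      refine Finset.sum_congr rfl fun φ hφ => ?_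
      simp only [Y, if_pos (Finset.mem_range.1 hφ)]
    refine ⟨Y, fun τ hτ p hp => ?_⟩
    interval_cases τ
    · rw [sum_slotEntry_zero u Y hp]
      simpa [slotRhs] using hsum p fun _ => 1
    · by_cases hpc : p + c < M * c
      · rw [sum_slotEntry_one hc u Y hpc, hsum p fun φ => φ, hsum (p + c) fun φ => W - 1 - φ]
        have := hg _ (Nat.mod_lt p hc)
        simp only [slotRhs, one_ne_zero, if_false, if_true, hpc, Nat.add_mod_right]
        omega
      · rw [sum_slotEntry_one_of_le u Y hpc]
        simp [slotRhs, hpc]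
    · by_cases hi : p < M
      · rw [sum_slotEntry_two u Y hi]
        simp only [slotRhs, OfNat.ofNat_ne_zero, OfNat.ofNat_ne_one, if_false, if_true, hi]
        have h1 : ∀ j ∈ Finset.range c,
            ∑ φ ∈ Finset.range W, u p j φ * Y (p * c + j) φ + Y (p * c + j) W =
            u p j (g j) + if j = 0 then c - 1 - ∑ j ∈ Finset.range c, u p j (g j) else 0 := by
          intro j hj
          rw [Finset.mem_range] at hj
          rw [hsum, mul_add_mod_of_lt hj]
          simp [Y, mul_add_mod_of_lt hj, mul_add_div_of_lt hj]
        rw [Finset.sum_congr rfl h1, Finset.sum_add_distrib, Finset.sum_ite_eq',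
          if_pos (Finset.mem_range.2 hc)]
        -- A satisfying block keeps the sum at most `c - 1`, so the truncated difference that
        -- defines the slack is exact.
        have h2 : ∑ j ∈ Finset.range c, u p j (g j) < ∑ j ∈ Finset.range c, 1 := by
          obtain ⟨j, hj, h0⟩ := hsat p hi
          exact Finset.sum_lt_sum (fun j _ => hu _ _ _) ⟨j, Finset.mem_range.2 hj, by omega⟩
        simp at h2
        omega
      · rw [sum_slotEntry_two_of_le u Y hi]
        simp [slotRhs, hi]

/-- The path-width of the column matroid of the constraint matrix is at most `c + 4`. -/
theorem columnPathWidth_ipMatrix_le {c M W : ℕ} (hc : 0 < c) (hM : 0 < M)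
    (u : ℕ → ℕ → ℕ → ℕ) : IP.columnPathWidth (ipMatrix c M W u) ≤ c + 4 := by
  have hs : 0 < M * c := Nat.mul_pos hM hc
  refine pathWidth_columnMatroid_le _ (Nat.mul_pos hs (Nat.succ_pos W)) (c + 3) (by omega) ?_
  intro t
  let q := t / (W + 1)
  -- The rows that may cross the cut inside slot `q`: its selection row, the equality rows `p` with
  -- `p ≤ q ≤ p + c`, and the row of its clause. These are `1 + (c + 1) + 1` rows.
  let R₀ : Finset ℕ := {q} ∪ (Finset.Icc (q - c) q).image (fun p => M * c + p) ∪
    {2 * (M * c) + q / c}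
  have hcard : R₀.card ≤ c + 3 := by
    refine (Finset.card_union_le _ _).trans ?_
    have h1 := Finset.card_union_le {q} ((Finset.Icc (q - c) q).image (fun p => M * c + p))
    have h2 := Finset.card_image_le (s := Finset.Icc (q - c) q) (f := fun p => M * c + p)
    simp only [Finset.card_singleton, Nat.card_Icc] at h1 h2 ⊢
    omega
  refine ⟨Finset.univ.filter fun r => r.1 ∈ R₀, ?_, ?_⟩
  · refine le_trans ?_ hcard
    refine Finset.card_le_card_of_injOn (fun r => r.1) (fun r hr => ?_)
      (fun a _ b _ h => Fin.ext h)
    simpa using hr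
  · rintro ⟨r, hr⟩ hnot
    simp only [Finset.mem_filter, Finset.mem_univ, true_and] at hnot
    have hdm := Nat.div_add_mod r (M * c)
    have hp : r % (M * c) < M * c := Nat.mod_lt _ hs
    have hτ : r / (M * c) < 3 := Nat.div_lt_of_lt_mul (by rwa [mul_comm])
    simp only [Matrix.map_apply, Nat.cast_eq_zero, ipMatrix, ipEntry]
    generalize r % (M * c) = p at *
    generalize r / (M * c) = τ at *
    have hleft : ∀ x, x ≤ t → x / (W + 1) ≤ q := fun x hx => Nat.div_le_div_right hx
    have hright : ∀ x, t < x → q ≤ x / (W + 1) := fun x hx => Nat.div_le_div_right hx.le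
    simp only [R₀, Finset.mem_union, Finset.mem_singleton, Finset.mem_image, Finset.mem_Icc,
      not_or, not_exists] at hnot
    obtain ⟨⟨hn0, hn1⟩, hn2⟩ := hnot
    have h12 : p < q ∨ q < p ∨ p = q := by omega
    interval_cases τ
    · rcases lt_or_gt_of_ne (show p ≠ q by omega) with h | h
      · right
        intro x hx
        have := hright x hx
        simp only [slotEntry, if_true]
        rw [if_neg (by omega)]
      · left
        intro x hx
        have := hleft x hx
        simp only [slotEntry, if_true]
        rw [if_neg (by omega)]
    · have hn := hn1 p
      -- An equality row outside `R₀` has both its slots `p` and `p + c` before `q`, or both after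
      -- `q`.
      rcases lt_or_gt_of_ne (show p + c ≠ q by omega) with h | h
      · right
        intro x hx
        have := hright x hx
        simp only [slotEntry, one_ne_zero, if_false, if_true]
        rw [if_neg (show x.1 / (W + 1) ≠ p by omega), if_neg (show x.1 / (W + 1) ≠ p + c by omega)]
        simp
      · left
        intro x hx
        have := hleft x hx
        simp only [slotEntry, one_ne_zero, if_false, if_true]
        rw [if_neg (show x.1 / (W + 1) ≠ p by omega), if_neg (show x.1 / (W + 1) ≠ p + c by omega)]
        simp
    · rcases lt_or_gt_of_ne (show p ≠ q / c by omega) with h | h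
      · right
        intro x hx
        have := Nat.div_le_div_right (c := c) (hright x hx)
        simp only [slotEntry, OfNat.ofNat_ne_zero, OfNat.ofNat_ne_one, if_false]
        rw [if_neg (by omega)]
      · left
        intro x hx
        have := Nat.div_le_div_right (c := c) (hleft x hx)
        simp only [slotEntry, OfNat.ofNat_ne_zero, OfNat.ofNat_ne_one, if_false]
        rw [if_neg (by omega)]

/-! ### Satisfiability in terms of the values of blocks of variables -/

/-- One step of reading an encoded formula. The state consists of the number of the current clause,
the number of the next literal in the clause, and an array with `q` entries per clause to which the
literals are copied. -/
def scanStep (q : ℕ) (s : ℕ × ℕ × (ℕ → ℕ)) (x : ℕ) : ℕ × ℕ × (ℕ → ℕ) :=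
  if x = 0 then (s.1 + 1, 0, s.2.2)
  else (s.1, s.2.1 + 1, Function.update s.2.2 (s.1 * q + s.2.1) x)

/-- The state after reading a list of numbers. -/
def scan (q : ℕ) (l : List ℕ) : ℕ × ℕ × (ℕ → ℕ) :=
  l.foldl (scanStep q) (0, 0, fun _ => 0)

/-- The number that encodes a literal. -/
def litCode {n : ℕ} (l : Fin n × Bool) : ℕ := 2 * (l.1 : ℕ) + if l.2 then 2 else 1

theorem litCode_pos {n : ℕ} (l : Fin n × Bool) : 0 < litCode l := by
  unfold litCode
  split_ifs <;> omega

theorem litCode_le {n : ℕ} (l : Fin n × Bool) : litCode l ≤ 2 * n := by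
  have := l.1.2
  unfold litCode
  split_ifs <;> omega

/-- The bound `k + C.length ≤ q` keeps the literals inside the window of `q` entries reserved for
clause `i`. -/
theorem foldl_scanStep_map_litCode {n q : ℕ} (C : List (Fin n × Bool)) (i k : ℕ) (lit : ℕ → ℕ)
    (h : k + C.length ≤ q) :
    ∃ lit', (C.map litCode).foldl (scanStep q) (i, k, lit) = (i, k + C.length, lit') ∧
      ∀ a b, b < q → lit' (a * q + b) =
        if a = i ∧ k ≤ b ∧ b < k + C.length then (C.map litCode).getD (b - k) 0
        else lit (a * q + b) := by
  induction C generalizing k lit with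
  | nil =>
    refine ⟨lit, rfl, fun a b _ => ?_⟩
    rw [if_neg]
    simp only [List.length_nil]
    omega
  | cons l C ih =>
    rw [List.length_cons] at h
    obtain ⟨lit', h1, h2⟩ := ih (k + 1) (Function.update lit (i * q + k) (litCode l)) (by omega)
    refine ⟨lit', ?_, fun a b hb => ?_⟩
    · rw [List.map_cons, List.foldl_cons, scanStep, if_neg (litCode_pos l).ne', h1,
        List.length_cons]
      simp only [Prod.mk.injEq, true_and, and_true]
      omega
    · rw [h2 a b hb, List.length_cons]
      by_cases hab : a = i ∧ b = k
      · obtain ⟨rfl, rfl⟩ := hab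
        rw [if_neg (by omega), if_pos (by omega)]
        simp
      · have hne : a * q + b ≠ i * q + k := by
          intro h
          have h1 := congrArg (· / q) h
          have h2 := congrArg (· % q) h
          simp only [mul_add_div_of_lt hb, mul_add_div_of_lt (show k < q by omega),
            mul_add_mod_of_lt hb, mul_add_mod_of_lt (show k < q by omega)] at h1 h2
          exact hab ⟨h1, h2⟩
        rw [Function.update_of_ne hne]
        by_cases hb' : a = i ∧ k + 1 ≤ b ∧ b < k + 1 + C.length
        · rw [if_pos hb', if_pos (by omega), show b - k = (b - (k + 1)) + 1 by omega]
          simp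
        · rw [if_neg hb', if_neg (by omega)]

theorem encode_cons {n : ℕ} (C : List (Fin n × Bool)) (ψ : CNFFormula n) :
    CNFFormula.encode (C :: ψ) = C.map litCode ++ [0] ++ CNFFormula.encode ψ := rfl

/-- The windows not yet reached must be zero, so that clauses shorter than `q` are padded by `0`,
which is not the code of a literal. -/
theorem foldl_scanStep_encode {n q : ℕ} (ψ : CNFFormula n) (h : ∀ C ∈ ψ, C.length ≤ q)
    (i : ℕ) (lit : ℕ → ℕ) (hlit : ∀ a b, i ≤ a → b < q → lit (a * q + b) = 0) :
    ∃ lit', ψ.encode.foldl (scanStep q) (i, 0, lit) = (i + ψ.length, 0, lit') ∧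
      ∀ a b, b < q → lit' (a * q + b) =
        if i ≤ a then ((ψ.getD (a - i) []).map litCode).getD b 0 else lit (a * q + b) := by
  induction ψ generalizing i lit with
  | nil =>
    refine ⟨lit, rfl, fun a b hb => ?_⟩
    split_ifs with hi
    · simp [hlit a b hi hb]
    · rfl
  | cons C ψ ih =>
    obtain ⟨lit₁, h1, h2⟩ := foldl_scanStep_map_litCode C i 0 lit
      (by simpa using h C List.mem_cons_self)
    obtain ⟨lit₂, h3, h4⟩ := ih (fun C hC => h C (List.mem_cons_of_mem _ hC)) (i + 1) lit₁ (by
      intro a b ha hb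
      rw [h2 a b hb, if_neg (by omega), hlit a b (by omega) hb])
    refine ⟨lit₂, ?_, fun a b hb => ?_⟩
    · rw [encode_cons, List.foldl_append, List.foldl_append, h1, List.foldl_cons, List.foldl_nil,
        scanStep, if_pos rfl, h3, List.length_cons]
      simp only [Prod.mk.injEq, and_true]
      omega
    · rw [h4 a b hb, h2 a b hb]
      rcases lt_trichotomy a i with ha | rfl | ha
      · rw [if_neg (by omega), if_neg (by omega), if_neg (by omega)]
      · rw [if_neg (by omega), if_pos le_rfl]
        simp only [true_and, zero_le, zero_add, Nat.sub_zero, Nat.sub_self,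
          List.getD_cons_zero]
        split_ifs with hb'
        · rfl
        · rw [hlit a b le_rfl hb, List.getD_eq_default _ _ (by simpa using hb')]
      · rw [if_pos (by omega), if_pos (by omega), show a - i = (a - (i + 1)) + 1 by omega]
        simp

theorem scan_encode {n q : ℕ} (ψ : CNFFormula n) (h : ∀ C ∈ ψ, C.length ≤ q) :
    (scan q ψ.encode).1 = ψ.length ∧
      ∀ a b, b < q → (scan q ψ.encode).2.2 (a * q + b) =
        ((ψ.getD a []).map litCode).getD b 0 := by
  obtain ⟨lit, h1, h2⟩ := foldl_scanStep_encode ψ h 0 (fun _ => 0) (fun _ _ _ _ => rfl)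
  rw [scan, h1]
  exact ⟨by simp, fun a b hb => by simpa using h2 a b hb⟩

/-- Whether the literal with code `x` belongs to block `j` and is true if this block has the value
`φ`; the array `pow` contains the powers of two. -/
def litSat (L : ℕ) (pow : ℕ → ℕ) (x j φ : ℕ) : ℕ :=
  if x ≠ 0 ∧ (x - 1) / 2 / L = j ∧ φ / pow ((x - 1) / 2 % L) % 2 = (x - 1) % 2 then 1 else 0

/-- Whether the value `φ` of block `j` satisfies none of the `q` literals of the clause `i`. -/
def unsat (q L : ℕ) (pow lit : ℕ → ℕ) (i j φ : ℕ) : ℕ :=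
  ∏ k ∈ Finset.range q, (1 - litSat L pow (lit (i * q + k)) j φ)

theorem unsat_le_one (q L : ℕ) (pow lit : ℕ → ℕ) (i j φ : ℕ) : unsat q L pow lit i j φ ≤ 1 :=
  Finset.prod_le_one' fun _ _ => Nat.sub_le _ _

theorem unsat_eq_zero_iff (q L : ℕ) (pow lit : ℕ → ℕ) (i j φ : ℕ) :
    unsat q L pow lit i j φ = 0 ↔ ∃ k < q, litSat L pow (lit (i * q + k)) j φ = 1 := by
  unfold unsat
  rw [Finset.prod_eq_zero_iff]
  refine exists_congr fun k => and_congr Finset.mem_range ?_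
  have : litSat L pow (lit (i * q + k)) j φ ≤ 1 := by
    unfold litSat
    split_ifs <;> simp
  omega

/-- A code minus one is `2v` plus the sign bit; variable `v` is bit `v % L` of the value of block `v
/ L`. -/
theorem litSat_litCode {n L : ℕ} {pow : ℕ → ℕ} (hL : 0 < L) (hpow : ∀ i < L, pow i = 2 ^ i)
    (l : Fin n × Bool) (j φ : ℕ) :
    litSat L pow (litCode l) j φ = 1 ↔
      (l.1 : ℕ) / L = j ∧ φ.testBit ((l.1 : ℕ) % L) = l.2 := by
  obtain ⟨v, b⟩ := l
  have h1 : (litCode (v, b) - 1) / 2 = v := by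
    unfold litCode
    cases b <;> (simp; try omega)
  have h2 : (litCode (v, b) - 1) % 2 = if b then 1 else 0 := by
    unfold litCode
    cases b <;> simp
  unfold litSat
  rw [h1, h2, hpow _ (Nat.mod_lt _ hL), Nat.testBit_eq_decide_div_mod_eq]
  have h3 := (litCode_pos (v, b)).ne'
  cases b <;> simp [h3]

/-- A formula is satisfiable exactly if values of the blocks can be chosen such that every clause
contains a true literal. -/
theorem exists_blocks_iff_satisfiable {n q c L : ℕ} (ψ : CNFFormula n)
    (h : ∀ C ∈ ψ, C.length ≤ q) (hL : 0 < L) (hn : n ≤ c * L) (pow : ℕ → ℕ)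
    (hpow : ∀ i < L, pow i = 2 ^ i) :
    (∃ g : ℕ → ℕ, (∀ j < c, g j < 2 ^ L) ∧ ∀ i < ψ.length, ∃ j < c,
      unsat q L pow (scan q ψ.encode).2.2 i j (g j) = 0) ↔ ψ.Satisfiable := by
  have hlit := (scan_encode ψ h).2
  constructor
  · rintro ⟨g, -, hg⟩
    refine ⟨fun v => (g ((v : ℕ) / L)).testBit ((v : ℕ) % L), fun C hC => ?_⟩
    obtain ⟨i, hi, rfl⟩ := List.getElem_of_mem hC
    obtain ⟨j, -, hu⟩ := hg i hi
    obtain ⟨k, hk, hs⟩ := (unsat_eq_zero_iff _ _ _ _ _ _ _).1 hu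
    rw [hlit i k hk, List.getD_eq_getElem _ _ hi] at hs
    have hkl : k < ψ[i].length := by
      by_contra hcon
      rw [List.getD_eq_default _ _ (by simpa using hcon)] at hs
      simp [litSat] at hs
    rw [List.getD_eq_getElem _ _ (by simpa using hkl), List.getElem_map,
      litSat_litCode hL hpow] at hs
    obtain ⟨rfl, hbit⟩ := hs
    exact ⟨ψ[i][k], List.getElem_mem hkl, hbit⟩
  · rintro ⟨φ, hφ⟩
    -- The blocks may have room for more than `n` variables; the surplus bits are set to `false`.
    let bit : ℕ → ℕ → Bool := fun j t => if h : j * L + t < n then φ ⟨j * L + t, h⟩ else false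
    refine ⟨fun j => Nat.ofBits fun t : Fin L => bit j t, fun j _ => Nat.ofBits_lt_two_pow _, ?_⟩
    intro i hi
    obtain ⟨l, hl, hval⟩ := hφ ψ[i] (List.getElem_mem hi)
    obtain ⟨k, hk, rfl⟩ := List.getElem_of_mem hl
    have hv := (ψ[i][k].1).2
    refine ⟨(ψ[i][k].1 : ℕ) / L, Nat.div_lt_of_lt_mul (by rw [mul_comm]; omega), ?_⟩
    have hkq : k < q := hk.trans_le (h _ (List.getElem_mem hi))
    rw [unsat_eq_zero_iff]
    refine ⟨k, hkq, ?_⟩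
    rw [hlit i k hkq, List.getD_eq_getElem _ _ hi, List.getD_eq_getElem _ _ (by simpa using hk),
      List.getElem_map, litSat_litCode hL hpow]
    refine ⟨rfl, ?_⟩
    rw [Nat.testBit_ofBits_lt _ _ (Nat.mod_lt _ hL)]
    simp only [bit, Nat.div_add_mod', hv, dite_true]
    exact hval

/-! ### Bounds for reading an encoded formula -/

theorem encode_length_le {n q : ℕ} (ψ : CNFFormula n) (h : ∀ C ∈ ψ, C.length ≤ q) :
    ψ.encode.length ≤ ψ.length * (q + 1) := by
  induction ψ with
  | nil => simp [CNFFormula.encode]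
  | cons C ψ ih =>
    have := ih fun C hC => h C (List.mem_cons_of_mem _ hC)
    have := h C List.mem_cons_self
    rw [encode_cons]
    simp only [List.length_append, List.length_map, List.length_cons, List.length_nil, Nat.succ_mul]
    omega

theorem encode_getD_le {n : ℕ} (ψ : CNFFormula n) (t : ℕ) : ψ.encode.getD t 0 ≤ 2 * n := by
  have hmem : ∀ x ∈ ψ.encode, x ≤ 2 * n := by
    intro x hx
    obtain ⟨C, -, hx⟩ := List.mem_flatMap.1 hx
    rcases List.mem_append.1 hx with hx | hx
    · obtain ⟨l, -, rfl⟩ := List.mem_map.1 hx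
      exact litCode_le l
    · simp at hx
      omega
  by_cases ht : t < ψ.encode.length
  · rw [List.getD_eq_getElem _ _ ht]
    exact hmem _ (List.getElem_mem ht)
  · rw [List.getD_eq_default _ _ (by omega)]
    omega

theorem foldl_scanStep_fst (q : ℕ) (l : List ℕ) (s : ℕ × ℕ × (ℕ → ℕ)) :
    (l.foldl (scanStep q) s).1 = s.1 + l.count 0 := by
  induction l generalizing s with
  | nil => rfl
  | cons x l ih =>
    rw [List.foldl_cons, ih, scanStep]
    split_ifs with hx
    · subst hx
      rw [List.count_cons_self]
      omega
    · rw [List.count_cons_of_ne (by simpa using hx)]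

/-- A nonempty encoding ends with `0`, so a proper prefix misses at least one clause end. Hence a
loop that counts clauses reads exactly the whole encoding. -/
theorem scan_fst_lt {n q : ℕ} (ψ : CNFFormula n) (h : ∀ C ∈ ψ, C.length ≤ q) {t : ℕ}
    (ht : t < ψ.encode.length) : (scan q (ψ.encode.take t)).1 < ψ.length := by
  have h1 := (scan_encode ψ h).1
  unfold scan at h1 ⊢
  rw [foldl_scanStep_fst] at h1 ⊢
  have h2 : ψ.encode.count 0 = (ψ.encode.take t).count 0 + (ψ.encode.drop t).count 0 := by
    rw [← List.count_append, List.take_append_drop]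
  have h3 : 0 < (ψ.encode.drop t).count 0 := by
    rw [List.count_pos_iff]
    have hne : ψ.encode ≠ [] := by
      intro h
      simp [h] at ht
    have hlast : ∀ ψ : CNFFormula n, ∀ hne : ψ.encode ≠ [], ψ.encode.getLast hne = 0 := by
      intro ψ
      induction ψ with
      | nil => intro hne; exact absurd rfl hne
      | cons C ψ ih =>
        intro hne
        by_cases h0 : CNFFormula.encode ψ = []
        · simp [encode_cons, h0]
        · simp only [encode_cons]
          rw [List.getLast_append_of_ne_nil _ h0]
          exact ih h0
    have hd : ψ.encode.drop t ≠ [] := by simpa using ht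
    rw [← hlast ψ hne, ← List.getLast_drop hd]
    exact List.getLast_mem hd
  omega

theorem scan_take_succ (q : ℕ) (l : List ℕ) {t : ℕ} (ht : t < l.length) :
    scan q (l.take (t + 1)) = scanStep q (scan q (l.take t)) (l.getD t 0) := by
  rw [scan, scan, List.take_succ_eq_append_getElem ht, List.foldl_append, List.foldl_cons,
    List.foldl_nil, List.getD_eq_getElem _ _ ht]

theorem scan_take_fst_le {n q : ℕ} (ψ : CNFFormula n) (h : ∀ C ∈ ψ, C.length ≤ q) (t : ℕ) :
    (scan q (ψ.encode.take t)).1 ≤ ψ.length := by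
  by_cases ht : t < ψ.encode.length
  · exact (scan_fst_lt ψ h ht).le
  · rw [List.take_of_length_le (by omega), (scan_encode ψ h).1]

theorem scan_take_bounds (q : ℕ) (l : List ℕ) (B : ℕ) (hB : ∀ t, l.getD t 0 ≤ B) (t : ℕ)
    (ht : t ≤ l.length) :
    (scan q (l.take t)).2.1 ≤ t ∧ ∀ a, (scan q (l.take t)).2.2 a ≤ B := by
  induction t with
  | zero => simp [scan]
  | succ t ih =>
    obtain ⟨h1, h2⟩ := ih (by omega)
    rw [scan_take_succ q l (by omega), scanStep]
    split_ifs
    · exact ⟨Nat.zero_le _, h2⟩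
    · refine ⟨by simp only; omega, fun a => ?_⟩
      simp only [Function.update_apply]
      split_ifs
      · exact hB t
      · exact h2 a

/-! ### Running times of programs -/

namespace RAM

/-- The program halts within time `T` with memory `σ'`. -/
def RunsTo (P : Prog) (σ : State) (T : ℕ) (σ' : State) : Prop :=
  ∃ t ≤ T, Exec P σ t σ'

theorem RunsTo.mono {P : Prog} {σ σ' : State} {T T' : ℕ} (h : RunsTo P σ T σ') (hT : T ≤ T') :
    RunsTo P σ T' σ' := by
  obtain ⟨t, ht, h⟩ := h
  exact ⟨t, ht.trans hT, h⟩

theorem RunsTo.assign {σ σ' : State} {x : ℕ} {e : Expr} {T : ℕ} (hT : e.cost σ + 1 ≤ T)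
    (h : σ.setReg x (e.eval σ) = σ') : RunsTo (.assign x e) σ T σ' :=
  ⟨_, hT, h ▸ .assign σ x e⟩

theorem RunsTo.store {σ σ' : State} {c : ℕ} {i e : Expr} {T₁ T₂ : ℕ} (h₁ : i.cost σ + 1 ≤ T₁)
    (h₂ : e.cost σ + 1 ≤ T₂) (h : σ.setArr c (i.eval σ) (e.eval σ) = σ') :
    RunsTo (.store c i e) σ (T₁ + T₂) σ' :=
  ⟨i.cost σ + e.cost σ + 1, by omega, h ▸ Exec.store σ c i e⟩

theorem RunsTo.seq {P Q : Prog} {σ₁ σ₂ σ₃ : State} {T₁ T₂ : ℕ} (h₁ : RunsTo P σ₁ T₁ σ₂)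
    (h₂ : RunsTo Q σ₂ T₂ σ₃) : RunsTo (.seq P Q) σ₁ (T₁ + T₂) σ₃ := by
  obtain ⟨t₁, ht₁, h₁⟩ := h₁
  obtain ⟨t₂, ht₂, h₂⟩ := h₂
  exact ⟨_, Nat.add_le_add ht₁ ht₂, .seq h₁ h₂⟩

theorem RunsTo.ite_true {e : Expr} {P Q : Prog} {σ σ' : State} {U T : ℕ} (he : e.eval σ ≠ 0)
    (hU : e.cost σ + 1 ≤ U) (h : RunsTo P σ T σ') : RunsTo (.ite e P Q) σ (U + T) σ' := by
  obtain ⟨t, ht, h⟩ := h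
  exact ⟨_, Nat.add_le_add hU ht, .ite_true he h⟩

theorem RunsTo.ite_false {e : Expr} {P Q : Prog} {σ σ' : State} {U T : ℕ} (he : e.eval σ = 0)
    (hU : e.cost σ + 1 ≤ U) (h : RunsTo Q σ T σ') : RunsTo (.ite e P Q) σ (U + T) σ' := by
  obtain ⟨t, ht, h⟩ := h
  exact ⟨_, Nat.add_le_add hU ht, .ite_false he h⟩

/-- A loop that runs through the states `S 0`, …, `S N`. -/
theorem RunsTo.while {e : Expr} {P : Prog} (S : ℕ → State) {N U T : ℕ}
    (he : ∀ k < N, e.eval (S k) ≠ 0) (he' : e.eval (S N) = 0)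
    (hU : ∀ k ≤ N, e.cost (S k) + 1 ≤ U) (hP : ∀ k < N, RunsTo P (S k) T (S (k + 1))) :
    RunsTo (.while e P) (S 0) ((N + 1) * (U + T)) (S N) := by
  -- Induction on the number `j` of iterations still to come.
  have key : ∀ j ≤ N, RunsTo (.while e P) (S (N - j)) ((j + 1) * (U + T)) (S N) := by
    intro j
    induction j with
    | zero =>
      intro _
      exact ⟨_, by have := hU N le_rfl; simp only [Nat.sub_zero]; omega, .while_false he'⟩
    | succ j ih =>
      intro hj
      obtain ⟨t₂, ht₂, h₂⟩ := ih (by omega)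
      obtain ⟨t₁, ht₁, h₁⟩ := hP (N - (j + 1)) (by omega)
      rw [show N - (j + 1) + 1 = N - j by omega] at h₁
      refine ⟨_, ?_, .while_true (he _ (by omega)) h₁ h₂⟩
      have := hU (N - (j + 1)) (by omega)
      rw [Nat.succ_mul (j + 1)]
      omega
  simpa using key N le_rfl

/-- All numbers in the memory are at most `V`. -/
def State.Bounded (σ : State) (V : ℕ) : Prop :=
  (∀ x, σ.reg x ≤ V) ∧ ∀ c i, σ.arr c i ≤ V

/-- The number of subexpressions. -/
def Expr.nodes : Expr → ℕ
  | lit _ => 1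
  | reg _ => 1
  | get _ i => i.nodes + 1
  | add e₁ e₂ => e₁.nodes + e₂.nodes + 1
  | sub e₁ e₂ => e₁.nodes + e₂.nodes + 1
  | mul e₁ e₂ => e₁.nodes + e₂.nodes + 1
  | div e₁ e₂ => e₁.nodes + e₂.nodes + 1

/-- The largest constant. -/
def Expr.maxLit : Expr → ℕ
  | lit c => c
  | reg _ => 0
  | get _ i => i.maxLit
  | add e₁ e₂ => max e₁.maxLit e₂.maxLit
  | sub e₁ e₂ => max e₁.maxLit e₂.maxLit
  | mul e₁ e₂ => max e₁.maxLit e₂.maxLit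
  | div e₁ e₂ => max e₁.maxLit e₂.maxLit

/-- Exponents add up along the expression; for sums, `V ≥ 2` makes room for both terms. Array
contents are at most `V` whatever the index. -/
theorem Expr.eval_le_pow {σ : State} {V : ℕ} (hV : 2 ≤ V) (hσ : σ.Bounded V) (e : Expr)
    (he : e.maxLit ≤ V) : e.eval σ ≤ V ^ e.nodes := by
  have hmono : ∀ {a b : ℕ}, a ≤ b → V ^ a ≤ V ^ b := fun h => Nat.pow_le_pow_right (by omega) h
  induction e with
  | lit c => simpa [eval, nodes, maxLit] using he
  | reg x => simpa [eval, nodes] using hσ.1 x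
  | get c i ih =>
    refine (hσ.2 c _).trans ?_
    simpa [nodes] using hmono (show 1 ≤ i.nodes + 1 by omega)
  | add e₁ e₂ h₁ h₂ =>
    simp only [maxLit, max_le_iff] at he
    have h₁ := (h₁ he.1).trans (hmono (show e₁.nodes ≤ e₁.nodes + e₂.nodes by omega))
    have h₂ := (h₂ he.2).trans (hmono (show e₂.nodes ≤ e₁.nodes + e₂.nodes by omega))
    simp only [eval, nodes, pow_succ]
    nlinarith
  | sub e₁ e₂ h₁ h₂ =>
    simp only [maxLit, max_le_iff] at he
    exact (Nat.sub_le _ _).trans ((h₁ he.1).trans (hmono (by simp only [nodes]; omega)))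
  | mul e₁ e₂ h₁ h₂ =>
    simp only [maxLit, max_le_iff] at he
    simp only [eval, nodes]
    exact (Nat.mul_le_mul (h₁ he.1) (h₂ he.2)).trans (by rw [← pow_add]; exact hmono (by omega))
  | div e₁ e₂ h₁ h₂ =>
    simp only [maxLit, max_le_iff] at he
    exact (Nat.div_le_self _ _).trans ((h₁ he.1).trans (hmono (by simp only [nodes]; omega)))

/-- By `V < 2 ^ V`, a power `V ^ k` has at most `k * V` bits. A logarithmic bound is not needed, as
factors polynomial in `V` are harmless. -/
theorem Expr.size_eval_le {σ : State} {V : ℕ} (hV : 2 ≤ V) (hσ : σ.Bounded V) (e : Expr)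
    (he : e.maxLit ≤ V) : Nat.size (e.eval σ) ≤ e.nodes * V := by
  rw [Nat.size_le]
  refine (e.eval_le_pow hV hσ he).trans_lt ?_
  rw [mul_comm, pow_mul]
  refine Nat.pow_lt_pow_left Nat.lt_two_pow_self ?_
  cases e <;> simp [nodes]

theorem Expr.cost_le {σ : State} {V : ℕ} (hV : 2 ≤ V) (hσ : σ.Bounded V) (e : Expr)
    (he : e.maxLit ≤ V) : e.cost σ ≤ e.nodes * (1 + e.nodes * V) := by
  have hs := e.size_eval_le hV hσ he
  induction e with
  | lit c => simpa [cost, nodes, eval] using hs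
  | reg x => simpa [cost, nodes, eval] using hs
  | get c i ih =>
    have ih := ih he (i.size_eval_le hV hσ he)
    simp only [cost, nodes, eval] at hs ⊢
    nlinarith [Nat.zero_le (i.nodes * V)]
  | add e₁ e₂ h₁ h₂ =>
    simp only [maxLit, max_le_iff] at he
    have h₁ := h₁ he.1 (e₁.size_eval_le hV hσ he.1)
    have h₂ := h₂ he.2 (e₂.size_eval_le hV hσ he.2)
    simp only [cost, nodes, eval] at hs ⊢
    nlinarith [Nat.zero_le (e₁.nodes * V), Nat.zero_le (e₂.nodes * V),
      Nat.zero_le (e₁.nodes * e₂.nodes * V)]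
  | sub e₁ e₂ h₁ h₂ =>
    simp only [maxLit, max_le_iff] at he
    have h₁ := h₁ he.1 (e₁.size_eval_le hV hσ he.1)
    have h₂ := h₂ he.2 (e₂.size_eval_le hV hσ he.2)
    simp only [cost, nodes, eval] at hs ⊢
    nlinarith [Nat.zero_le (e₁.nodes * V), Nat.zero_le (e₂.nodes * V),
      Nat.zero_le (e₁.nodes * e₂.nodes * V)]
  | mul e₁ e₂ h₁ h₂ =>
    simp only [maxLit, max_le_iff] at he
    have h₁ := h₁ he.1 (e₁.size_eval_le hV hσ he.1)
    have h₂ := h₂ he.2 (e₂.size_eval_le hV hσ he.2)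
    simp only [cost, nodes, eval] at hs ⊢
    nlinarith [Nat.zero_le (e₁.nodes * V), Nat.zero_le (e₂.nodes * V),
      Nat.zero_le (e₁.nodes * e₂.nodes * V)]
  | div e₁ e₂ h₁ h₂ =>
    simp only [maxLit, max_le_iff] at he
    have h₁ := h₁ he.1 (e₁.size_eval_le hV hσ he.1)
    have h₂ := h₂ he.2 (e₂.size_eval_le hV hσ he.2)
    simp only [cost, nodes, eval] at hs ⊢
    nlinarith [Nat.zero_le (e₁.nodes * V), Nat.zero_le (e₂.nodes * V),
      Nat.zero_le (e₁.nodes * e₂.nodes * V)]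

/-- A uniform bound for the cost of expressions with at most `K` subexpressions and with constants
at most `K`. -/
theorem Expr.cost_add_one_le {σ : State} {V K : ℕ} (hV : 2 ≤ V) (hσ : σ.Bounded V) (hKV : K ≤ V)
    (e : Expr) (he : e.nodes ≤ K ∧ e.maxLit ≤ K) : e.cost σ + 1 ≤ (2 * K * K + 1) * V := by
  have h1 := e.cost_le hV hσ (he.2.trans hKV)
  have h2 : e.nodes * (1 + e.nodes * V) ≤ K * (1 + K * V) :=
    Nat.mul_le_mul he.1 (Nat.add_le_add_left (Nat.mul_le_mul_right V he.1) 1)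
  have h3 : K ≤ K * K * V := by
    rcases Nat.eq_zero_or_pos K with rfl | hK
    · simp
    · nlinarith [Nat.mul_le_mul hK hV, Nat.mul_le_mul hK (Nat.mul_le_mul hK hV)]
  nlinarith

/-! ### Renaming of registers and arrays -/

/-- The expression with renamed registers and arrays. -/
def Expr.rename (ρ κ : ℕ → ℕ) : Expr → Expr
  | lit c => lit c
  | reg x => reg (ρ x)
  | get c i => get (κ c) (i.rename ρ κ)
  | add e₁ e₂ => add (e₁.rename ρ κ) (e₂.rename ρ κ)
  | sub e₁ e₂ => sub (e₁.rename ρ κ) (e₂.rename ρ κ)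
  | mul e₁ e₂ => mul (e₁.rename ρ κ) (e₂.rename ρ κ)
  | div e₁ e₂ => div (e₁.rename ρ κ) (e₂.rename ρ κ)

/-- The program with renamed registers and arrays. -/
def Prog.rename (ρ κ : ℕ → ℕ) : Prog → Prog
  | skip => skip
  | assign x e => assign (ρ x) (e.rename ρ κ)
  | store c i e => store (κ c) (i.rename ρ κ) (e.rename ρ κ)
  | seq P Q => seq (P.rename ρ κ) (Q.rename ρ κ)
  | ite e P Q => ite (e.rename ρ κ) (P.rename ρ κ) (Q.rename ρ κ)
  | .while e P => .while (e.rename ρ κ) (P.rename ρ κ)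

/-- The memory `τ` contains the memory `σ` under the new names. -/
def State.RenamedTo (ρ κ : ℕ → ℕ) (σ τ : State) : Prop :=
  (∀ x, τ.reg (ρ x) = σ.reg x) ∧ ∀ c, τ.arr (κ c) = σ.arr c

theorem Expr.eval_rename {ρ κ : ℕ → ℕ} {σ τ : State} (h : σ.RenamedTo ρ κ τ) (e : Expr) :
    (e.rename ρ κ).eval τ = e.eval σ := by
  induction e with
  | lit c => rfl
  | reg x => exact h.1 x
  | get c i ih => simp only [rename, eval, ih, h.2]
  | add e₁ e₂ h₁ h₂ => simp only [rename, eval, h₁, h₂]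
  | sub e₁ e₂ h₁ h₂ => simp only [rename, eval, h₁, h₂]
  | mul e₁ e₂ h₁ h₂ => simp only [rename, eval, h₁, h₂]
  | div e₁ e₂ h₁ h₂ => simp only [rename, eval, h₁, h₂]

theorem Expr.cost_rename {ρ κ : ℕ → ℕ} {σ τ : State} (h : σ.RenamedTo ρ κ τ) (e : Expr) :
    (e.rename ρ κ).cost τ = e.cost σ := by
  induction e with
  | lit c => rfl
  | reg x => simp only [rename, cost, h.1]
  | get c i ih => simp only [rename, cost, ih, h.2, eval_rename h]
  | add e₁ e₂ h₁ h₂ => simp only [rename, cost, h₁, h₂, eval_rename h]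
  | sub e₁ e₂ h₁ h₂ => simp only [rename, cost, h₁, h₂, eval_rename h]
  | mul e₁ e₂ h₁ h₂ => simp only [rename, cost, h₁, h₂, eval_rename h]
  | div e₁ e₂ h₁ h₂ => simp only [rename, cost, h₁, h₂, eval_rename h]

theorem State.RenamedTo.setReg {ρ κ : ℕ → ℕ} (hρ : Function.Injective ρ) {σ τ : State}
    (h : σ.RenamedTo ρ κ τ) (x v : ℕ) :
    (σ.setReg x v).RenamedTo ρ κ (τ.setReg (ρ x) v) := by
  refine ⟨fun y => ?_, h.2⟩
  simp only [State.setReg, Function.update_apply, hρ.eq_iff, h.1]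

theorem State.RenamedTo.setArr {ρ κ : ℕ → ℕ} (hκ : Function.Injective κ) {σ τ : State}
    (h : σ.RenamedTo ρ κ τ) (c i v : ℕ) :
    (σ.setArr c i v).RenamedTo ρ κ (τ.setArr (κ c) i v) := by
  refine ⟨h.1, fun d => ?_⟩
  simp only [State.setArr, Function.update_apply, hκ.eq_iff, h.2]

/-- The renamed program simulates the original one with the same running time. -/
theorem Exec.rename {ρ κ : ℕ → ℕ} (hρ : Function.Injective ρ) (hκ : Function.Injective κ)
    {P : Prog} {σ σ' : State} {t : ℕ} (hP : Exec P σ t σ') :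
    ∀ τ, σ.RenamedTo ρ κ τ → ∃ τ', Exec (P.rename ρ κ) τ t τ' ∧ σ'.RenamedTo ρ κ τ' := by
  induction hP with
  | skip σ => exact fun τ h => ⟨τ, .skip τ, h⟩
  | assign σ x e =>
    intro τ h
    have := Exec.assign τ (ρ x) (e.rename ρ κ)
    rw [Expr.eval_rename h, Expr.cost_rename h] at this
    exact ⟨_, this, h.setReg hρ _ _⟩
  | store σ c i e =>
    intro τ h
    have := Exec.store τ (κ c) (i.rename ρ κ) (e.rename ρ κ)
    rw [Expr.eval_rename h, Expr.eval_rename h, Expr.cost_rename h, Expr.cost_rename h] at this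
    exact ⟨_, this, h.setArr hκ _ _ _⟩
  | seq _ _ ih₁ ih₂ =>
    intro τ h
    obtain ⟨τ₁, e₁, h₁⟩ := ih₁ τ h
    obtain ⟨τ₂, e₂, h₂⟩ := ih₂ τ₁ h₁
    exact ⟨τ₂, .seq e₁ e₂, h₂⟩
  | @ite_true e P Q σ σ' t he _ ih =>
    intro τ h
    obtain ⟨τ', e₁, h₁⟩ := ih τ h
    rw [← Expr.cost_rename h e]
    exact ⟨τ', .ite_true (by rwa [Expr.eval_rename h]) e₁, h₁⟩
  | @ite_false e P Q σ σ' t he _ ih =>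
    intro τ h
    obtain ⟨τ', e₁, h₁⟩ := ih τ h
    rw [← Expr.cost_rename h e]
    exact ⟨τ', .ite_false (by rwa [Expr.eval_rename h]) e₁, h₁⟩
  | @while_true e P σ₁ σ₂ σ₃ t₁ t₂ he _ _ ih₁ ih₂ =>
    intro τ h
    obtain ⟨τ₁, e₁, h₁⟩ := ih₁ τ h
    obtain ⟨τ₂, e₂, h₂⟩ := ih₂ τ₁ h₁
    rw [← Expr.cost_rename h e]
    exact ⟨τ₂, .while_true (by rwa [Expr.eval_rename h]) e₁ e₂, h₂⟩
  | @while_false e P σ he =>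
    intro τ h
    rw [← Expr.cost_rename h e]
    exact ⟨τ, .while_false (by rwa [Expr.eval_rename h]), h⟩

/-! ### Derived expressions -/

namespace Expr

/-- `1` if the values are equal, otherwise `0`. -/
def eqE (a b : Expr) : Expr := sub (lit 1) (add (sub a b) (sub b a))

/-- `1` if the first value is less than the second, otherwise `0`. -/
def ltE (a b : Expr) : Expr := sub (lit 1) (sub (lit 1) (sub b a))

/-- The remainder. -/
def modE (a b : Expr) : Expr := sub a (mul (div a b) b)

/-- The second value if the first is `1`, and the third if the first is `0`. -/
def iteE (a b c : Expr) : Expr := add (mul a b) (mul (sub (lit 1) a) c)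

theorem eval_eqE (σ : State) (a b : Expr) :
    (eqE a b).eval σ = if a.eval σ = b.eval σ then 1 else 0 := by
  simp only [eqE, eval]
  split_ifs <;> omega

theorem eval_ltE (σ : State) (a b : Expr) :
    (ltE a b).eval σ = if a.eval σ < b.eval σ then 1 else 0 := by
  simp only [ltE, eval]
  split_ifs <;> omega

theorem eval_modE (σ : State) (a b : Expr) : (modE a b).eval σ = a.eval σ % b.eval σ := by
  simp only [modE, eval]
  have := Nat.div_add_mod' (a.eval σ) (b.eval σ)
  omega

theorem eval_iteE (σ : State) (a b c : Expr) (p : Prop) [Decidable p]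
    (h : a.eval σ = if p then 1 else 0) :
    (iteE a b c).eval σ = if p then b.eval σ else c.eval σ := by
  simp only [iteE, eval, h]
  split_ifs <;> simp

theorem eval_mul_ite (σ : State) (a b : Expr) (p q : Prop) [Decidable p] [Decidable q]
    (ha : a.eval σ = if p then 1 else 0) (hb : b.eval σ = if q then 1 else 0) :
    (mul a b).eval σ = if p ∧ q then 1 else 0 := by
  simp only [eval, ha, hb]
  split_ifs <;> simp_all

end Expr

end RAM

/-! ### The program that writes down the integer program -/

namespace RAM

/-- A memory that uses the registers `0` to `7` and the arrays `0` and `2` to `5`. -/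
def st (n M L x t i k z : ℕ) (a₀ a₂ a₃ a₄ a₅ : ℕ → ℕ) : State where
  reg
    | 0 => n
    | 1 => M
    | 2 => L
    | 3 => x
    | 4 => t
    | 5 => i
    | 6 => k
    | 7 => z
    | _ => 0
  arr
    | 0 => a₀
    | 2 => a₂
    | 3 => a₃
    | 4 => a₄
    | 5 => a₅
    | _ => fun _ => 0

theorem State.ext_apply {σ τ : State} (hr : ∀ x, σ.reg x = τ.reg x) (ha : ∀ c, σ.arr c = τ.arr c) :
    σ = τ := by
  cases σ
  cases τ
  simp only [State.mk.injEq]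
  exact ⟨funext hr, funext ha⟩

section
variable (n M L x t i k z v w : ℕ) (a₀ a₂ a₃ a₄ a₅ : ℕ → ℕ)

/-- Assignments keep the memory in the form `st`, so loop invariants can be given as explicit
families of such memories. -/
theorem st_setReg_two : (st n M L x t i k z a₀ a₂ a₃ a₄ a₅).setReg 2 v =
    st n M v x t i k z a₀ a₂ a₃ a₄ a₅ :=
  State.ext_apply (fun y => match y with
    | 0 => rfl | 1 => rfl | 2 => rfl | 3 => rfl | 4 => rfl | 5 => rfl | 6 => rfl | 7 => rfl
    | _ + 8 => rfl) fun _ => rfl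

theorem st_setReg_three : (st n M L x t i k z a₀ a₂ a₃ a₄ a₅).setReg 3 v =
    st n M L v t i k z a₀ a₂ a₃ a₄ a₅ :=
  State.ext_apply (fun y => match y with
    | 0 => rfl | 1 => rfl | 2 => rfl | 3 => rfl | 4 => rfl | 5 => rfl | 6 => rfl | 7 => rfl
    | _ + 8 => rfl) fun _ => rfl

theorem st_setReg_four : (st n M L x t i k z a₀ a₂ a₃ a₄ a₅).setReg 4 v =
    st n M L x v i k z a₀ a₂ a₃ a₄ a₅ :=
  State.ext_apply (fun y => match y with
    | 0 => rfl | 1 => rfl | 2 => rfl | 3 => rfl | 4 => rfl | 5 => rfl | 6 => rfl | 7 => rfl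
    | _ + 8 => rfl) fun _ => rfl

theorem st_setReg_five : (st n M L x t i k z a₀ a₂ a₃ a₄ a₅).setReg 5 v =
    st n M L x t v k z a₀ a₂ a₃ a₄ a₅ :=
  State.ext_apply (fun y => match y with
    | 0 => rfl | 1 => rfl | 2 => rfl | 3 => rfl | 4 => rfl | 5 => rfl | 6 => rfl | 7 => rfl
    | _ + 8 => rfl) fun _ => rfl

theorem st_setReg_six : (st n M L x t i k z a₀ a₂ a₃ a₄ a₅).setReg 6 v =
    st n M L x t i v z a₀ a₂ a₃ a₄ a₅ :=
  State.ext_apply (fun y => match y with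
    | 0 => rfl | 1 => rfl | 2 => rfl | 3 => rfl | 4 => rfl | 5 => rfl | 6 => rfl | 7 => rfl
    | _ + 8 => rfl) fun _ => rfl

theorem st_setReg_seven : (st n M L x t i k z a₀ a₂ a₃ a₄ a₅).setReg 7 v =
    st n M L x t i k v a₀ a₂ a₃ a₄ a₅ :=
  State.ext_apply (fun y => match y with
    | 0 => rfl | 1 => rfl | 2 => rfl | 3 => rfl | 4 => rfl | 5 => rfl | 6 => rfl | 7 => rfl
    | _ + 8 => rfl) fun _ => rfl

theorem st_setArr_two : (st n M L x t i k z a₀ a₂ a₃ a₄ a₅).setArr 2 v w =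
    st n M L x t i k z a₀ (Function.update a₂ v w) a₃ a₄ a₅ :=
  State.ext_apply (fun _ => rfl) fun c => match c with
    | 0 => rfl | 1 => rfl | 2 => rfl | 3 => rfl | 4 => rfl | 5 => rfl | _ + 6 => rfl

theorem st_setArr_three : (st n M L x t i k z a₀ a₂ a₃ a₄ a₅).setArr 3 v w =
    st n M L x t i k z a₀ a₂ (Function.update a₃ v w) a₄ a₅ :=
  State.ext_apply (fun _ => rfl) fun c => match c with
    | 0 => rfl | 1 => rfl | 2 => rfl | 3 => rfl | 4 => rfl | 5 => rfl | _ + 6 => rfl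

theorem st_setArr_four : (st n M L x t i k z a₀ a₂ a₃ a₄ a₅).setArr 4 v w =
    st n M L x t i k z a₀ a₂ a₃ (Function.update a₄ v w) a₅ :=
  State.ext_apply (fun _ => rfl) fun c => match c with
    | 0 => rfl | 1 => rfl | 2 => rfl | 3 => rfl | 4 => rfl | 5 => rfl | _ + 6 => rfl

theorem st_setArr_five : (st n M L x t i k z a₀ a₂ a₃ a₄ a₅).setArr 5 v w =
    st n M L x t i k z a₀ a₂ a₃ a₄ (Function.update a₅ v w) :=
  State.ext_apply (fun _ => rfl) fun c => match c with
    | 0 => rfl | 1 => rfl | 2 => rfl | 3 => rfl | 4 => rfl | 5 => rfl | _ + 6 => rfl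

end

theorem st_bounded {n M L x t i k z V : ℕ} {a₀ a₂ a₃ a₄ a₅ : ℕ → ℕ} (hn : n ≤ V) (hM : M ≤ V)
    (hL : L ≤ V) (hx : x ≤ V) (ht : t ≤ V) (hi : i ≤ V) (hk : k ≤ V) (hz : z ≤ V)
    (h₀ : ∀ j, a₀ j ≤ V) (h₂ : ∀ j, a₂ j ≤ V) (h₃ : ∀ j, a₃ j ≤ V) (h₄ : ∀ j, a₄ j ≤ V)
    (h₅ : ∀ j, a₅ j ≤ V) : (st n M L x t i k z a₀ a₂ a₃ a₄ a₅).Bounded V := by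
  refine ⟨fun y => ?_, fun c => ?_⟩
  · match y with
    | 0 => exact hn
    | 1 => exact hM
    | 2 => exact hL
    | 3 => exact hx
    | 4 => exact ht
    | 5 => exact hi
    | 6 => exact hk
    | 7 => exact hz
    | _ + 8 => exact Nat.zero_le V
  · match c with
    | 0 => exact h₀
    | 1 => exact fun _ => Nat.zero_le V
    | 2 => exact h₂
    | 3 => exact h₃
    | 4 => exact h₄
    | 5 => exact h₅
    | _ + 6 => exact fun _ => Nat.zero_le V

/-! #### The expressions for the entries -/

namespace Expr

/-- `W = 2 ^ L`. -/
def widthE : Expr := get 2 (reg 2)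

/-- Computes `litSat`. -/
def litSatE (x j φ : Expr) : Expr :=
  mul (ltE (lit 0) x)
    (mul (eqE (div (div (sub x (lit 1)) (lit 2)) (reg 2)) j)
      (eqE (modE (div φ (get 2 (modE (div (sub x (lit 1)) (lit 2)) (reg 2)))) (lit 2))
        (modE (sub x (lit 1)) (lit 2))))

/-- Computes the first `k` factors of `unsat`. -/
def unsatE (q : ℕ) (i j φ : Expr) : ℕ → Expr
  | 0 => lit 1
  | k + 1 => mul (unsatE q i j φ k)
      (sub (lit 1) (litSatE (get 3 (add (mul i (lit q)) (lit k))) j φ))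

/-- Computes `slotEntry`. -/
def slotEntryE (c q : ℕ) (τ p p' φ : Expr) : Expr :=
  iteE (eqE τ (lit 0)) (mul (eqE p' p) (ltE φ widthE))
    (iteE (eqE τ (lit 1))
      (iteE (mul (ltE φ widthE) (ltE (add p (lit c)) (mul (reg 1) (lit c))))
        (iteE (eqE p' p) φ
          (iteE (eqE p' (add p (lit c))) (sub (sub widthE (lit 1)) φ) (lit 0))) (lit 0))
      (iteE (eqE (div p' (lit c)) p)
        (iteE (ltE φ widthE) (unsatE q p (modE p' (lit c)) φ q) (lit 1)) (lit 0)))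

/-- The number of slots. -/
def slotsE (c : ℕ) : Expr := mul (reg 1) (lit c)

/-- The number of rows. -/
def rowsE (c : ℕ) : Expr := mul (lit 3) (slotsE c)

/-- The number of columns. -/
def colsE (c : ℕ) : Expr := mul (slotsE c) (add widthE (lit 1))

/-- The entry of the matrix whose number is in register `7`. -/
def entryE (c q : ℕ) : Expr :=
  slotEntryE c q (div (div (reg 7) (colsE c)) (slotsE c)) (modE (div (reg 7) (colsE c)) (slotsE c))
    (div (modE (reg 7) (colsE c)) (add widthE (lit 1)))
    (modE (modE (reg 7) (colsE c)) (add widthE (lit 1)))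

/-- The entry of the right-hand side whose number is in register `7`. -/
def rhsE (c : ℕ) : Expr :=
  -- The counter runs through all positions of the matrix, hence beyond the number of rows; the
  -- right-hand side is padded by zeros there.
  iteE (ltE (reg 7) (rowsE c))
    (iteE (eqE (div (reg 7) (slotsE c)) (lit 0)) (lit 1)
      (iteE (eqE (div (reg 7) (slotsE c)) (lit 1))
        (iteE (ltE (add (modE (reg 7) (slotsE c)) (lit c)) (slotsE c))
          (sub widthE (lit 1)) (lit 0))
        (iteE (ltE (modE (reg 7) (slotsE c)) (reg 1)) (lit (c - 1)) (lit 0))))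
    (lit 0)

theorem eval_litSatE (σ : State) (x j φ : Expr) :
    (litSatE x j φ).eval σ =
      litSat (σ.reg 2) (σ.arr 2) (x.eval σ) (j.eval σ) (φ.eval σ) := by
  have h := eval_mul_ite σ _ _ _ _ (eval_ltE σ (lit 0) x) (eval_mul_ite σ _ _ _ _
    (eval_eqE σ (div (div (sub x (lit 1)) (lit 2)) (reg 2)) j)
    (eval_eqE σ (modE (div φ (get 2 (modE (div (sub x (lit 1)) (lit 2)) (reg 2)))) (lit 2))
        (modE (sub x (lit 1)) (lit 2))))
  refine h.trans ?_
  simp only [litSat, eval_modE, eval, Nat.pos_iff_ne_zero]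

/-- Since `q` is fixed, the product is unrolled into one expression whose size is a constant. -/
theorem eval_unsatE (σ : State) (q : ℕ) (i j φ : Expr) (k : ℕ) :
    (unsatE q i j φ k).eval σ = ∏ k ∈ Finset.range k,
      (1 - litSat (σ.reg 2) (σ.arr 2) (σ.arr 3 (i.eval σ * q + k)) (j.eval σ) (φ.eval σ)) := by
  induction k with
  | zero => rfl
  | succ k ih =>
    rw [Finset.prod_range_succ, ← ih]
    simp only [unsatE, eval, eval_litSatE]

theorem eval_slotEntryE (σ : State) (c q : ℕ) (τ p p' φ : Expr) :
    (slotEntryE c q τ p p' φ).eval σ =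
      slotEntry c (σ.reg 1) (σ.arr 2 (σ.reg 2)) (unsat q (σ.reg 2) (σ.arr 2) (σ.arr 3))
        (τ.eval σ) (p.eval σ) (p'.eval σ) (φ.eval σ) := by
  unfold slotEntryE slotEntry
  rw [eval_iteE _ _ _ _ _ (eval_eqE σ _ _),
    eval_mul_ite σ _ _ _ _ (eval_eqE σ _ _) (eval_ltE σ _ _),
    eval_iteE _ _ _ _ _ (eval_eqE σ _ _),
    eval_iteE _ _ _ _ _ (eval_mul_ite σ _ _ _ _ (eval_ltE σ _ _) (eval_ltE σ _ _)),
    eval_iteE _ _ _ _ _ (eval_eqE σ _ _),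
    eval_iteE _ _ _ _ _ (eval_eqE σ _ _),
    eval_iteE _ _ _ _ _ (eval_eqE σ _ _),
    eval_iteE _ _ _ _ _ (eval_ltE σ _ _), eval_unsatE, eval_modE]
  rfl

theorem eval_entryE (σ : State) (c q : ℕ) :
    (entryE c q).eval σ =
      ipEntry c (σ.reg 1) (σ.arr 2 (σ.reg 2)) (unsat q (σ.reg 2) (σ.arr 2) (σ.arr 3))
        (σ.reg 7 / (σ.reg 1 * c * (σ.arr 2 (σ.reg 2) + 1)))
        (σ.reg 7 % (σ.reg 1 * c * (σ.arr 2 (σ.reg 2) + 1))) := by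
  rw [entryE, eval_slotEntryE, ipEntry]
  simp only [eval, eval_modE, colsE, slotsE, widthE]

theorem eval_rhsE (σ : State) (c : ℕ) :
    (rhsE c).eval σ = if σ.reg 7 < 3 * (σ.reg 1 * c) then
      ipRhs c (σ.reg 1) (σ.arr 2 (σ.reg 2)) (σ.reg 7) else 0 := by
  unfold rhsE ipRhs slotRhs
  rw [eval_iteE _ _ _ _ _ (eval_ltE σ _ _), eval_iteE _ _ _ _ _ (eval_eqE σ _ _),
    eval_iteE _ _ _ _ _ (eval_eqE σ _ _), eval_iteE _ _ _ _ _ (eval_ltE σ _ _),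
    eval_iteE _ _ _ _ _ (eval_ltE σ _ _)]
  simp only [eval, eval_modE, rowsE, slotsE, widthE]

end Expr

/-! #### The program -/

/-- Computes the powers of two. -/
def powProg (c : ℕ) : Prog :=
  -- The block length `n / c + 1` is positive and satisfies `n ≤ c * L`.
  .seq (.assign 2 (.add (.div (.reg 0) (.lit c)) (.lit 1)))
    (.seq (.store 2 (.lit 0) (.lit 1))
      (.while (.sub (.reg 2) (.reg 3))
        (.seq (.store 2 (.add (.reg 3) (.lit 1)) (.mul (.lit 2) (.get 2 (.reg 3))))
          (.assign 3 (.add (.reg 3) (.lit 1))))))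

/-- Reads the formula. -/
def scanProg (q : ℕ) : Prog :=
  -- The input does not contain the length of the encoding, so the loop counts completed clauses.
  .while (.sub (.reg 1) (.reg 5))
    (.seq
      (.ite (.get 0 (.reg 4))
        (.seq (.store 3 (.add (.mul (.reg 5) (.lit q)) (.reg 6)) (.get 0 (.reg 4)))
          (.assign 6 (.add (.reg 6) (.lit 1))))
        (.seq (.assign 5 (.add (.reg 5) (.lit 1))) (.assign 6 (.lit 0))))
      (.assign 4 (.add (.reg 4) (.lit 1))))

/-- Writes the matrix and the right-hand side. -/
def writeProg (c q : ℕ) : Prog :=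
  .while (.sub (.mul (Expr.rowsE c) (Expr.colsE c)) (.reg 7))
    (.seq (.store 4 (.reg 7) (Expr.entryE c q))
      (.seq (.store 5 (.reg 7) (Expr.rhsE c)) (.assign 7 (.add (.reg 7) (.lit 1)))))

/-- The new names of the registers. -/
def renameReg (x : ℕ) : ℕ := if x = 0 then 0 else x + 8

/-- Constructs the integer program. -/
def reduceProg (c q : ℕ) : Prog :=
  .seq (powProg c) (.seq (scanProg q) (.seq (writeProg c q)
    (.seq (.assign 9 (Expr.colsE c)) (.assign 0 (Expr.rowsE c)))))

/-- Decides satisfiability, given a program for integer programming. -/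
def satProg (c q : ℕ) (P : Prog) : Prog :=
  .ite (.reg 1) (.seq (reduceProg c q) (P.rename renameReg (· + 4))) (.assign 0 (.lit 1))

end RAM

/-! ### Running times of the three loops. -/

namespace RAM

/-- The powers of two up to `2 ^ x`. -/
def powArr (x k : ℕ) : ℕ := if k ≤ x then 2 ^ k else 0

theorem powArr_le {x L : ℕ} (h : x ≤ L) (k : ℕ) : powArr x k ≤ 2 ^ L := by
  unfold powArr
  split_ifs
  · exact Nat.pow_le_pow_right (by omega) (by omega)
  · exact Nat.zero_le _

theorem update_powArr (x : ℕ) : Function.update (powArr x) (x + 1) (2 * powArr x x) =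
    powArr (x + 1) := by
  funext k
  simp only [Function.update_apply, powArr]
  split_ifs with h1 h2 h3 h4 <;> first | omega | rfl | skip
  subst h1
  simp [pow_succ, mul_comm]

/-- The function `F` below `z`, and zero otherwise. -/
def prefixArr (F : ℕ → ℕ) (z k : ℕ) : ℕ := if k < z then F k else 0

theorem update_prefixArr (F : ℕ → ℕ) (z : ℕ) : Function.update (prefixArr F z) z (F z) =
    prefixArr F (z + 1) := by
  funext k
  simp only [Function.update_apply, prefixArr]
  split_ifs with h1 h2 h3 h4 <;> first | omega | rfl | (subst h1; rfl)

theorem prefixArr_zero (F : ℕ → ℕ) : prefixArr F 0 = fun _ => 0 := by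
  funext k
  simp [prefixArr]

theorem prefixArr_le {F : ℕ → ℕ} {B : ℕ} (h : ∀ k, F k ≤ B) (z k : ℕ) : prefixArr F z k ≤ B := by
  unfold prefixArr
  split_ifs
  · exact h k
  · exact Nat.zero_le _

/-- Loop invariant: after `x` rounds the array holds the powers up to `2 ^ x`. Every step costs at
most the uniform bound `U`, and `10 * V * U` covers all rounds generously. -/
theorem powProg_runsTo {c q n M V K : ℕ} {enc : ℕ → ℕ} (hK : c + q + 30 ≤ K) (hKV : K ≤ V)
    (hn : n ≤ V) (hM : M ≤ V) (hL : n / c + 1 ≤ V) (henc : ∀ j, enc j ≤ V)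
    (hpow : 2 ^ (n / c + 1) ≤ V) :
    RunsTo (powProg c) (st n M 0 0 0 0 0 0 enc (fun _ => 0) (fun _ => 0) (fun _ => 0) fun _ => 0)
      (10 * V * ((2 * K * K + 1) * V))
      (st n M (n / c + 1) (n / c + 1) 0 0 0 0 enc (powArr (n / c + 1)) (fun _ => 0) (fun _ => 0)
        fun _ => 0) := by
  have hU : ∀ (e : Expr) (σ : State), σ.Bounded V → e.nodes ≤ K ∧ e.maxLit ≤ K →
      e.cost σ + 1 ≤ (2 * K * K + 1) * V :=
    fun e σ hσ he => e.cost_add_one_le (by omega) hσ hKV he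
  generalize (2 * K * K + 1) * V = U at hU ⊢
  generalize hLdef : n / c + 1 = L at *
  have h0 : ∀ _ : ℕ, 0 ≤ V := fun _ => Nat.zero_le V
  have hz := Nat.zero_le V
  have hp : ∀ x ≤ L, ∀ j, powArr x j ≤ V := fun x hx j => (powArr_le hx j).trans hpow
  have hloop := RunsTo.while (e := .sub (.reg 2) (.reg 3))
    (P := .seq (.store 2 (.add (.reg 3) (.lit 1)) (.mul (.lit 2) (.get 2 (.reg 3))))
          (.assign 3 (.add (.reg 3) (.lit 1))))
    (fun x => st n M L x 0 0 0 0 enc (powArr x) (fun _ => 0) (fun _ => 0) fun _ => 0)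
    (N := L) (U := U) (T := U + U + U)
    (fun x hx => show L - x ≠ 0 by omega) (show L - L = 0 by omega)
    (fun x hx => hU _ _ (st_bounded hn hM hL (by omega) hz hz hz hz henc (hp x hx) h0 h0 h0)
      (by simp only [Expr.nodes, Expr.maxLit]; omega))
    (fun x hx => by
      refine .seq (.store (hU _ _ (st_bounded hn hM hL (by omega) hz hz hz hz henc
          (hp x hx.le) h0 h0 h0) (by simp only [Expr.nodes, Expr.maxLit]; omega))
        (hU _ _ (st_bounded hn hM hL (by omega) hz hz hz hz henc
          (hp x hx.le) h0 h0 h0) (by simp only [Expr.nodes, Expr.maxLit]; omega))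
        (st_setArr_two _ _ _ _ _ _ _ _ _ _ _ _ _ _ _)) ?_
      change RunsTo _ (st n M L x 0 0 0 0 enc
        (Function.update (powArr x) (x + 1) (2 * powArr x x)) _ _ _) _ _
      rw [update_powArr]
      exact .assign (hU _ _ (st_bounded hn hM hL (by omega) hz hz hz hz henc
          (hp (x + 1) hx) h0 h0 h0) (by simp only [Expr.nodes, Expr.maxLit]; omega))
          (st_setReg_three _ _ _ _ _ _ _ _ _ _ _ _ _ _))
  have hb := st_bounded hn hM hz hz hz hz hz hz henc h0 h0 h0 h0
  have hb' := st_bounded hn hM hL hz hz hz hz hz henc h0 h0 h0 h0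
  have hinit : Function.update (fun _ : ℕ => 0) 0 1 = powArr 0 := by
    funext k
    simp only [Function.update_apply, powArr]
    split_ifs <;> first | omega | (subst k; rfl)
  refine RunsTo.mono (.seq (.assign (hU _ _ hb (by simp only [Expr.nodes, Expr.maxLit]; omega))
    ((st_setReg_two _ _ _ _ _ _ _ _ _ _ _ _ _ _).trans (by
      change st n M (n / c + 1) _ _ _ _ _ _ _ _ _ _ = _
      rw [hLdef])))
    (.seq (.store (hU _ _ hb' (by simp only [Expr.nodes, Expr.maxLit]; omega))
      (hU _ _ hb' (by simp only [Expr.nodes, Expr.maxLit]; omega))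
      ((st_setArr_two _ _ _ _ _ _ _ _ _ _ _ _ _ _ _).trans (by
        change st n M L 0 0 0 0 0 enc (Function.update (fun _ : ℕ => 0) 0 1) _ _ _ = _
        rw [hinit]))) hloop)) ?_
  have h1 := Nat.mul_le_mul_right U hL
  have h2 : 30 * U ≤ V * U := Nat.mul_le_mul_right U (by omega)
  have : U + (U + U + (L + 1) * (U + (U + U + U))) = 7 * U + 4 * (L * U) := by ring
  rw [this, mul_assoc]
  omega

/-- Loop invariant: after `t` rounds the memory holds the state of `scan` on the first `t` symbols.
-/
theorem scanProg_runsTo {c q n L V K : ℕ} {pow : ℕ → ℕ} (ψ : CNFFormula n)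
    (hψ : ∀ C ∈ ψ, C.length ≤ q) (hK : c + q + 30 ≤ K) (hKV : K ≤ V)
    (hn : 2 * n ≤ V) (hM : ψ.length ≤ V) (hL : L ≤ V) (hpow : ∀ k, pow k ≤ V)
    (hT : ψ.encode.length ≤ V) :
    RunsTo (scanProg q) (st n ψ.length L L 0 0 0 0 (fun j => ψ.encode.getD j 0) pow
        (fun _ => 0) (fun _ => 0) fun _ => 0)
      (10 * V * ((2 * K * K + 1) * V))
      (st n ψ.length L L ψ.encode.length ψ.length (scan q ψ.encode).2.1 0
        (fun j => ψ.encode.getD j 0) pow (scan q ψ.encode).2.2 (fun _ => 0) fun _ => 0) := by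
  have hU : ∀ (e : Expr) (σ : State), σ.Bounded V → e.nodes ≤ K ∧ e.maxLit ≤ K →
      e.cost σ + 1 ≤ (2 * K * K + 1) * V :=
    fun e σ hσ he => e.cost_add_one_le (by omega) hσ hKV he
  generalize (2 * K * K + 1) * V = U at hU ⊢
  have h0 : ∀ _ : ℕ, 0 ≤ V := fun _ => Nat.zero_le V
  have hz := Nat.zero_le V
  have henc : ∀ j, ψ.encode.getD j 0 ≤ V := fun j => (encode_getD_le ψ j).trans hn
  have hbs := fun t ht => scan_take_bounds q ψ.encode V henc t ht
  have hloop := RunsTo.while (e := .sub (.reg 1) (.reg 5))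
    (P := .seq
      (.ite (.get 0 (.reg 4))
        (.seq (.store 3 (.add (.mul (.reg 5) (.lit q)) (.reg 6)) (.get 0 (.reg 4)))
          (.assign 6 (.add (.reg 6) (.lit 1))))
        (.seq (.assign 5 (.add (.reg 5) (.lit 1))) (.assign 6 (.lit 0))))
      (.assign 4 (.add (.reg 4) (.lit 1))))
    (fun t => st n ψ.length L L t (scan q (ψ.encode.take t)).1 (scan q (ψ.encode.take t)).2.1 0
      (fun j => ψ.encode.getD j 0) pow (scan q (ψ.encode.take t)).2.2 (fun _ => 0) fun _ => 0)
    (N := ψ.encode.length) (U := U) (T := U + (U + U + U) + U)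
    (fun t ht => by
      have := scan_fst_lt ψ hψ ht
      change ψ.length - (scan q (ψ.encode.take t)).1 ≠ 0
      omega)
    (by
      have := (scan_encode ψ hψ).1
      change ψ.length - (scan q (ψ.encode.take _)).1 = 0
      rw [List.take_length]
      omega)
    (fun t ht => hU _ _ (st_bounded (by omega) hM hL hL (by omega)
      ((scan_take_fst_le ψ hψ t).trans hM) (by have := (hbs t ht).1; omega) hz henc hpow
      (hbs t ht).2 h0 h0) (by simp only [Expr.nodes, Expr.maxLit]; omega))
    (fun t ht => by
      have hb := hbs t ht.le
      have hi := scan_fst_lt ψ hψ ht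
      have hstep := scan_take_succ q ψ.encode ht
      have hbd := st_bounded (show n ≤ V by omega) hM hL hL (show t ≤ V by omega)
        (show (scan q (ψ.encode.take t)).1 ≤ V by omega)
        (show (scan q (ψ.encode.take t)).2.1 ≤ V by omega) hz henc hpow hb.2 h0 h0
      have hb' := hbs (t + 1) ht
      have hi' := (scan_take_fst_le ψ hψ (t + 1)).trans hM
      refine .seq (σ₂ := st n ψ.length L L t (scan q (ψ.encode.take (t + 1))).1
        (scan q (ψ.encode.take (t + 1))).2.1 0 (fun j => ψ.encode.getD j 0) pow
        (scan q (ψ.encode.take (t + 1))).2.2 (fun _ => 0) fun _ => 0) ?_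
        (.assign (hU _ _ (st_bounded (show n ≤ V by omega) hM hL hL (show t ≤ V by omega)
          hi' (by omega) hz henc hpow hb'.2 h0 h0)
          (by simp only [Expr.nodes, Expr.maxLit]; omega))
          (st_setReg_four _ _ _ _ _ _ _ _ _ _ _ _ _ _))
      by_cases hx : ψ.encode.getD t 0 = 0
      · rw [scanStep, if_pos hx] at hstep
        rw [hstep]
        refine .ite_false hx (hU _ _ hbd (by simp only [Expr.nodes, Expr.maxLit]; omega))
          (RunsTo.mono (.seq (.assign (hU _ _ hbd (by simp only [Expr.nodes, Expr.maxLit]; omega))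
            (st_setReg_five _ _ _ _ _ _ _ _ _ _ _ _ _ _))
            (.assign (hU _ _ (st_bounded (show n ≤ V by omega) hM hL hL (show t ≤ V by omega)
              (show (scan q (ψ.encode.take t)).1 + 1 ≤ V by omega)
              (show (scan q (ψ.encode.take t)).2.1 ≤ V by omega) hz henc hpow hb.2 h0 h0)
              (by simp only [Expr.nodes, Expr.maxLit]; omega))
            (st_setReg_six _ _ _ _ _ _ _ _ _ _ _ _ _ _))) (Nat.le_add_right _ U))
      · rw [scanStep, if_neg hx] at hstep
        rw [hstep] at hb' ⊢
        exact .ite_true hx (hU _ _ hbd (by simp only [Expr.nodes, Expr.maxLit]; omega))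
          (.seq (.store (hU _ _ hbd (by simp only [Expr.nodes, Expr.maxLit]; omega))
            (hU _ _ hbd (by simp only [Expr.nodes, Expr.maxLit]; omega))
            (st_setArr_three _ _ _ _ _ _ _ _ _ _ _ _ _ _ _))
            (.assign (hU _ _ (st_bounded (show n ≤ V by omega) hM hL hL (show t ≤ V by omega)
              (show (scan q (ψ.encode.take t)).1 ≤ V by omega)
              (show (scan q (ψ.encode.take t)).2.1 ≤ V by omega) hz henc hpow hb'.2 h0 h0)
              (by simp only [Expr.nodes, Expr.maxLit]; omega))
            (st_setReg_six _ _ _ _ _ _ _ _ _ _ _ _ _ _))))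
  simp only [List.take_length, (scan_encode ψ hψ).1] at hloop
  refine hloop.mono ?_
  have h1 := Nat.mul_le_mul_right U hT
  have h2 : 30 * U ≤ V * U := Nat.mul_le_mul_right U (by omega)
  have : (ψ.encode.length + 1) * (U + (U + (U + U + U) + U)) =
    6 * U + 6 * (ψ.encode.length * U) := by ring
  rw [this, mul_assoc]
  omega

/-- Loop invariant: after `z` rounds the arrays `4` and `5` are the prefixes of length `z` of `ent`
and `rhs`. -/
theorem writeProg_runsTo {c q n M L x t k N V K : ℕ} {enc pow lit ent rhs : ℕ → ℕ}
    (hK : c + q + 30 ≤ K)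
    (hE : (Expr.entryE c q).nodes ≤ K ∧ (Expr.entryE c q).maxLit ≤ K)
    (hR : (Expr.rhsE c).nodes ≤ K ∧ (Expr.rhsE c).maxLit ≤ K) (hKV : K ≤ V)
    (hn : n ≤ V) (hM : M ≤ V) (hL : L ≤ V) (hx : x ≤ V) (ht : t ≤ V) (hk : k ≤ V)
    (henc : ∀ k, enc k ≤ V) (hpow : ∀ k, pow k ≤ V) (hlit : ∀ k, lit k ≤ V)
    (hent : ∀ k, ent k = ipEntry c M (pow L) (unsat q L pow lit)
      (k / (M * c * (pow L + 1))) (k % (M * c * (pow L + 1))))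
    (hrhs : ∀ k, rhs k = if k < 3 * (M * c) then ipRhs c M (pow L) k else 0)
    (hentV : ∀ k, ent k ≤ V) (hrhsV : ∀ k, rhs k ≤ V)
    (hN : N = 3 * (M * c) * (M * c * (pow L + 1))) (hNV : N ≤ V) :
    RunsTo (writeProg c q) (st n M L x t M k 0 enc pow lit (fun _ => 0) fun _ => 0)
      (10 * V * ((2 * K * K + 1) * V))
      (st n M L x t M k N enc pow lit (prefixArr ent N) (prefixArr rhs N)) := by
  have hU : ∀ (e : Expr) (σ : State), σ.Bounded V → e.nodes ≤ K ∧ e.maxLit ≤ K →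
      e.cost σ + 1 ≤ (2 * K * K + 1) * V :=
    fun e σ hσ he => e.cost_add_one_le (by omega) hσ hKV he
  generalize (2 * K * K + 1) * V = U at hU ⊢
  have hbd : ∀ z ≤ N, ∀ z₁ z₂, (st n M L x t M k z enc pow lit (prefixArr ent z₁)
      (prefixArr rhs z₂)).Bounded V := fun z hz z₁ z₂ =>
    st_bounded hn hM hL hx ht hM hk (hz.trans hNV) henc hpow hlit (prefixArr_le hentV z₁)
      (prefixArr_le hrhsV z₂)
  have hcond : ∀ z, (Expr.sub (.mul (Expr.rowsE c) (Expr.colsE c)) (.reg 7)).eval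
      (st n M L x t M k z enc pow lit (prefixArr ent z) (prefixArr rhs z)) = N - z := by
    intro z
    rw [hN]
    rfl
  have hloop := RunsTo.while (e := .sub (.mul (Expr.rowsE c) (Expr.colsE c)) (.reg 7))
    (P := .seq (.store 4 (.reg 7) (Expr.entryE c q))
      (.seq (.store 5 (.reg 7) (Expr.rhsE c)) (.assign 7 (.add (.reg 7) (.lit 1)))))
    (fun z => st n M L x t M k z enc pow lit (prefixArr ent z) (prefixArr rhs z))
    (N := N) (U := U) (T := U + U + (U + U + U))
    (fun z hz => by rw [hcond]; omega) (by rw [hcond]; omega)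
    (fun z hz => hU _ _ (hbd z hz z z) (by
      simp only [Expr.nodes, Expr.maxLit, Expr.rowsE, Expr.colsE, Expr.slotsE, Expr.widthE]
      omega))
    (fun z hz => by
      refine .seq (σ₂ := st n M L x t M k z enc pow lit (prefixArr ent (z + 1)) (prefixArr rhs z))
        (.store (hU _ _ (hbd z hz.le z z) (by simp only [Expr.nodes, Expr.maxLit]; omega))
          (hU _ _ (hbd z hz.le z z) hE)
          ((st_setArr_four _ _ _ _ _ _ _ _ _ _ _ _ _ _ _).trans ?_))
        (.seq (σ₂ := st n M L x t M k z enc pow lit (prefixArr ent (z + 1))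
            (prefixArr rhs (z + 1)))
          (.store (hU _ _ (hbd z hz.le (z + 1) z) (by simp only [Expr.nodes, Expr.maxLit]; omega))
          (hU _ _ (hbd z hz.le (z + 1) z) hR)
          ((st_setArr_five _ _ _ _ _ _ _ _ _ _ _ _ _ _ _).trans ?_))
        (.assign (hU _ _ (hbd z hz.le (z + 1) (z + 1))
          (by simp only [Expr.nodes, Expr.maxLit]; omega))
          (st_setReg_seven _ _ _ _ _ _ _ _ _ _ _ _ _ _)))
      · rw [Expr.eval_entryE]
        change st n M L x t M k z enc pow lit (Function.update (prefixArr ent z) z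
          (ipEntry c M (pow L) (unsat q L pow lit) (z / (M * c * (pow L + 1)))
            (z % (M * c * (pow L + 1))))) (prefixArr rhs z) = _
        rw [← hent, update_prefixArr]
      · rw [Expr.eval_rhsE]
        change st n M L x t M k z enc pow lit (prefixArr ent (z + 1))
          (Function.update (prefixArr rhs z) z
            (if z < 3 * (M * c) then ipRhs c M (pow L) z else 0)) = _
        rw [← hrhs, update_prefixArr])
  simp only [prefixArr_zero] at hloop
  refine hloop.mono ?_
  have h1 := Nat.mul_le_mul_right U hNV
  have h2 : 30 * U ≤ V * U := Nat.mul_le_mul_right U (by omega)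
  have : (N + 1) * (U + (U + U + (U + U + U))) = 6 * U + 6 * (N * U) := by ring
  rw [this, mul_assoc]
  omega

end RAM

theorem slotEntry_le {c M W : ℕ} {u : ℕ → ℕ → ℕ → ℕ} (hW : 0 < W) (hu : ∀ i j φ, u i j φ ≤ 1)
    (τ p p' φ : ℕ) : slotEntry c M W u τ p p' φ ≤ W := by
  have := hu p (p' % c) φ
  unfold slotEntry
  split_ifs <;> omega

theorem slotRhs_le (c M W τ p : ℕ) (hW : 0 < W) : slotRhs c M W τ p ≤ W + c := by
  unfold slotRhs
  split_ifs <;> omega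

/-! ### The complete reduction from satisfiability to integer programming. -/

namespace RAM

/-- A constant that depends only on the number of blocks and the size of the clauses. -/
def reduceConst (c q : ℕ) : ℕ :=
  (Expr.entryE c q).nodes + (Expr.entryE c q).maxLit + (Expr.rhsE c).nodes + (Expr.rhsE c).maxLit +
    12 * (q + 1) * (c + 1) ^ 2 + 30

/-- A bound for all numbers that occur in the construction. -/
def reduceBound (c q M L : ℕ) : ℕ := reduceConst c q * (M * M * 2 ^ L)

/-- The matrix of the integer program for a formula. -/
def satMatrix (c q : ℕ) {n : ℕ} (ψ : CNFFormula n) :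
    Matrix (Fin (3 * (ψ.length * c))) (Fin (ψ.length * c * (2 ^ (n / c + 1) + 1))) ℕ :=
  ipMatrix c ψ.length (2 ^ (n / c + 1))
    (unsat q (n / c + 1) (powArr (n / c + 1)) (scan q ψ.encode).2.2)

/-- The right-hand side of the integer program for a formula. -/
def satVector (c : ℕ) {n : ℕ} (ψ : CNFFormula n) : Fin (3 * (ψ.length * c)) → ℕ :=
  ipVector c ψ.length (2 ^ (n / c + 1))

theorem feasible_satMatrix_iff {c q n : ℕ} (hc : 0 < c) (ψ : CNFFormula n) (hM : 0 < ψ.length)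
    (hψ : ∀ C ∈ ψ, C.length ≤ q) :
    IP.Feasible (satMatrix c q ψ) (satVector c ψ) ↔ ψ.Satisfiable := by
  have hn : n ≤ c * (n / c + 1) := (Nat.lt_mul_div_succ n hc).le
  rw [← exists_blocks_iff_satisfiable ψ hψ (Nat.succ_pos _) hn (powArr (n / c + 1))
    (fun i hi => by simp [powArr, hi.le])]
  exact feasible_ipMatrix_iff hc hM _ (unsat_le_one _ _ _ _)

/-- Register `0` keeps its name because it returns the answer. The other registers and the arrays
are shifted so that, apart from the input, the program for (IP) sees only memory that is zero. -/
theorem renamedTo_toInput {m N : ℕ} (A : ℕ → ℕ → ℕ) (b : ℕ → ℕ) (σ : State)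
    (hreg : ∀ x, σ.reg (x + 10) = 0) (harr : ∀ c, σ.arr (c + 6) = fun _ => 0)
    (hA : ∀ i < m * N, σ.arr 4 i = A (i / N) (i % N)) (hA' : ∀ i, ¬ i < m * N → σ.arr 4 i = 0)
    (hb : ∀ i < m, σ.arr 5 i = b i) (hb' : ∀ i, ¬ i < m → σ.arr 5 i = 0) :
    (IP.toInput (fun (r : Fin m) (k : Fin N) => A r k) (fun r : Fin m => b r)).RenamedTo renameReg
      (· + 4) ((σ.setReg 9 N).setReg 0 m) := by
  constructor
  · intro x
    match x with
    | 0 => rfl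
    | 1 => rfl
    | x + 2 =>
      have h1 : renameReg (x + 2) = x + 10 := if_neg (by omega)
      rw [h1]
      change Function.update (Function.update σ.reg 9 N) 0 m (x + 10) = 0
      rw [Function.update_of_ne (by omega), Function.update_of_ne (by omega), hreg]
  · intro d
    match d with
    | 0 =>
      funext i
      change σ.arr 4 i = if h : i / N < m ∧ i % N < N then A (i / N) (i % N) else 0
      by_cases hi : i < m * N
      · have hN : 0 < N := by
          by_contra h
          have : N = 0 := by omega
          rw [this] at hi
          omega
        rw [hA i hi, dif_pos ⟨Nat.div_lt_of_lt_mul (by rwa [mul_comm]), Nat.mod_lt _ hN⟩]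
      · rw [hA' i hi, dif_neg]
        rintro ⟨h1, h2⟩
        exact hi ((Nat.div_lt_iff_lt_mul (by omega)).1 h1)
    | 1 =>
      funext i
      change σ.arr 5 i = if h : i < m then b i else 0
      split_ifs with hi
      · exact hb i hi
      · exact hb' i hi
    | d + 2 => exact harr d

/-- The number of matrix entries dominates: it is at most `6 * c^2 * M^2 * W`. For the variables, `n
< c * L` and `L < W` give `n ≤ c * W`. -/
theorem reduceBound_spec {c q n M T : ℕ} (hc : 0 < c) (hM : 0 < M) (hT : T ≤ M * (q + 1)) :
    c + q + 30 ≤ reduceConst c q ∧ reduceConst c q ≤ reduceBound c q M (n / c + 1) ∧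
    2 * n ≤ reduceBound c q M (n / c + 1) ∧ M ≤ reduceBound c q M (n / c + 1) ∧
    n / c + 1 ≤ reduceBound c q M (n / c + 1) ∧ T ≤ reduceBound c q M (n / c + 1) ∧
    2 ^ (n / c + 1) + c ≤ reduceBound c q M (n / c + 1) ∧
    3 * (M * c) * (M * c * (2 ^ (n / c + 1) + 1)) ≤ reduceBound c q M (n / c + 1) := by
  have hn : n < c * (n / c + 1) := Nat.lt_mul_div_succ n hc
  have hLW : n / c + 1 < 2 ^ (n / c + 1) := Nat.lt_two_pow_self
  have hW1 : 1 ≤ 2 ^ (n / c + 1) := Nat.one_le_two_pow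
  have hMW : 0 < M * M * 2 ^ (n / c + 1) := by positivity
  have hV : 12 * ((q + 1) * (c + 1) ^ 2 * (M * M * 2 ^ (n / c + 1))) ≤
      reduceBound c q M (n / c + 1) := by
    rw [reduceBound, ← mul_assoc]
    refine Nat.mul_le_mul_right _ ?_
    rw [reduceConst, mul_assoc]
    omega
  have hK : c + q + 30 ≤ reduceConst c q := by
    have : c + q ≤ 12 * (q + 1) * (c + 1) ^ 2 := by nlinarith [Nat.zero_le (q * c)]
    rw [reduceConst]
    omega
  have hKV : reduceConst c q ≤ reduceBound c q M (n / c + 1) := Nat.le_mul_of_pos_right _ hMW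
  generalize reduceBound c q M (n / c + 1) = V at *
  generalize reduceConst c q = K at *
  generalize n / c + 1 = L at *
  generalize 2 ^ L = W at *
  have hprod : ∀ {a b d e : ℕ}, a ≤ (q + 1) * (c + 1) ^ 2 → b ≤ M * M → d ≤ W →
      e = a * b * d → 12 * e ≤ V := by
    rintro a b d e ha hb hd rfl
    refine le_trans (Nat.mul_le_mul_left 12 ?_) hV
    rw [mul_assoc]
    exact Nat.mul_le_mul ha (Nat.mul_le_mul hb hd)
  have hMM : M ≤ M * M := Nat.le_mul_self M
  have hqc : q + 1 ≤ (q + 1) * (c + 1) ^ 2 := Nat.le_mul_of_pos_right _ (by positivity)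
  have hcc : (c + 1) ^ 2 ≤ (q + 1) * (c + 1) ^ 2 := Nat.le_mul_of_pos_left _ (by omega)
  have hcc' : c ≤ (c + 1) ^ 2 ∧ c * c ≤ (c + 1) ^ 2 ∧ 1 ≤ (c + 1) ^ 2 := by
    refine ⟨?_, ?_, ?_⟩ <;> nlinarith
  have hM1 : 1 ≤ M * M := Nat.one_le_iff_ne_zero.2 (by positivity)
  have hcW := hprod (a := c) (b := 1) (d := W) (by omega) hM1 le_rfl rfl
  have hWV := hprod (a := 1) (b := 1) (d := W) (by omega) hM1 le_rfl rfl
  have hMV := hprod (a := 1) (b := M) (d := 1) (by omega) hMM hW1 rfl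
  have hcV := hprod (a := c) (b := 1) (d := 1) (by omega) hM1 hW1 rfl
  have hTV := hprod (a := q + 1) (b := M) (d := 1) hqc hMM hW1 rfl
  have hNV := hprod (a := c * c) (b := M * M) (d := W) (by omega) le_rfl le_rfl rfl
  have hnW : n ≤ c * W := hn.le.trans (Nat.mul_le_mul_left c hLW.le)
  have hN : 3 * (M * c) * (M * c * (W + 1)) ≤ V := by
    refine le_trans ?_ hNV
    have : M * c * (W + 1) ≤ M * c * (2 * W) := Nat.mul_le_mul_left _ (by omega)
    have := Nat.mul_le_mul_left (3 * (M * c)) this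
    nlinarith
  simp only [mul_one, one_mul] at hcW hWV hMV hcV hTV
  rw [mul_comm] at hT
  omega

theorem toInput_eq_st {n : ℕ} (ψ : CNFFormula n) :
    ψ.toInput = st n ψ.length 0 0 0 0 0 0 (fun j => ψ.encode.getD j 0) (fun _ => 0)
      (fun _ => 0) (fun _ => 0) fun _ => 0 :=
  State.ext_apply (fun y => match y with
    | 0 => rfl | 1 => rfl | 2 => rfl | 3 => rfl | 4 => rfl | 5 => rfl | 6 => rfl | 7 => rfl
    | _ + 8 => rfl) fun c => match c with
    | 0 => rfl | 1 => rfl | 2 => rfl | 3 => rfl | 4 => rfl | 5 => rfl | _ + 6 => rfl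

theorem sizeProg_runsTo {c n M L x t i k z V K : ℕ} {a₀ a₂ a₃ a₄ a₅ : ℕ → ℕ}
    (hσ : (st n M L x t i k z a₀ a₂ a₃ a₄ a₅).Bounded V) (hK : c + 30 ≤ K) (hKV : K ≤ V)
    (hV : M * c * (a₂ L + 1) ≤ V) :
    RunsTo (.seq (.assign 9 (Expr.colsE c)) (.assign 0 (Expr.rowsE c)))
      (st n M L x t i k z a₀ a₂ a₃ a₄ a₅) (2 * ((2 * K * K + 1) * V))
      (((st n M L x t i k z a₀ a₂ a₃ a₄ a₅).setReg 9 (M * c * (a₂ L + 1))).setReg 0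
        (3 * (M * c))) := by
  have hU : ∀ (e : Expr) (σ : State), σ.Bounded V → e.nodes ≤ K ∧ e.maxLit ≤ K →
      e.cost σ + 1 ≤ (2 * K * K + 1) * V :=
    fun e σ hσ he => e.cost_add_one_le (by omega) hσ hKV he
  have hσ' : ((st n M L x t i k z a₀ a₂ a₃ a₄ a₅).setReg 9 (M * c * (a₂ L + 1))).Bounded V := by
    refine ⟨fun x => ?_, hσ.2⟩
    simp only [State.setReg, Function.update_apply]
    split_ifs
    · exact hV
    · exact hσ.1 x
  have hcols : (Expr.colsE c).nodes ≤ K ∧ (Expr.colsE c).maxLit ≤ K := by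
    simp only [Expr.nodes, Expr.maxLit, Expr.colsE, Expr.slotsE, Expr.widthE]
    omega
  have hrows : (Expr.rowsE c).nodes ≤ K ∧ (Expr.rowsE c).maxLit ≤ K := by
    simp only [Expr.nodes, Expr.maxLit, Expr.rowsE, Expr.slotsE]
    omega
  refine RunsTo.mono (.seq (.assign (hU _ _ hσ hcols) rfl) (.assign (hU _ _ hσ' hrows) rfl)) ?_
  omega

theorem reduceProg_runsTo {c q n : ℕ} (hc : 0 < c) (ψ : CNFFormula n) (hM : 0 < ψ.length)
    (hψ : ∀ C ∈ ψ, C.length ≤ q) :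
    ∃ τ, RunsTo (reduceProg c q) ψ.toInput
        (40 * (2 * reduceConst c q * reduceConst c q + 1) *
          reduceBound c q ψ.length (n / c + 1) ^ 2) τ ∧
      (IP.toInput (satMatrix c q ψ) (satVector c ψ)).RenamedTo renameReg (· + 4) τ := by
  obtain ⟨hK, hKV, hn, hMV, hL, hT, hW, hN⟩ :=
    reduceBound_spec (n := n) (q := q) hc hM (encode_length_le ψ hψ)
  have hpowL : powArr (n / c + 1) (n / c + 1) = 2 ^ (n / c + 1) := by simp [powArr]
  have hW1 : 1 ≤ 2 ^ (n / c + 1) := Nat.one_le_two_pow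
  have hpow : ∀ k, powArr (n / c + 1) k ≤ reduceBound c q ψ.length (n / c + 1) :=
    fun k => (powArr_le le_rfl k).trans (by omega)
  have henc : ∀ j, ψ.encode.getD j 0 ≤ reduceBound c q ψ.length (n / c + 1) :=
    fun j => (encode_getD_le ψ j).trans hn
  obtain ⟨hk, hlit⟩ := scan_take_bounds q ψ.encode _ henc _ le_rfl
  rw [List.take_length] at hk hlit
  have hE : (Expr.entryE c q).nodes ≤ reduceConst c q ∧
      (Expr.entryE c q).maxLit ≤ reduceConst c q := by
    rw [reduceConst]
    omega
  have hR : (Expr.rhsE c).nodes ≤ reduceConst c q ∧ (Expr.rhsE c).maxLit ≤ reduceConst c q := by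
    rw [reduceConst]
    omega
  unfold satMatrix satVector
  generalize reduceConst c q = K at *
  generalize reduceBound c q ψ.length (n / c + 1) = V at *
  have h1 := powProg_runsTo (c := c) (q := q) hK hKV (by omega) hMV hL henc (by omega)
  generalize n / c + 1 = L at *
  have h2 := scanProg_runsTo ψ hψ hK hKV hn hMV hL hpow hT
  have hu := unsat_le_one q L (powArr L) (scan q ψ.encode).2.2
  have hent : ∀ k, ipEntry c ψ.length (powArr L L) (unsat q L (powArr L) (scan q ψ.encode).2.2)
      (k / (ψ.length * c * (powArr L L + 1))) (k % (ψ.length * c * (powArr L L + 1))) ≤ V :=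
    fun k => (slotEntry_le (by omega) hu _ _ _ _).trans (by omega)
  have hrhs : ∀ k, (if k < 3 * (ψ.length * c) then ipRhs c ψ.length (powArr L L) k else 0) ≤ V := by
    intro k
    split_ifs
    · exact (slotRhs_le _ _ _ _ _ (by omega)).trans (by omega)
    · exact Nat.zero_le _
  have hN' : 3 * (ψ.length * c) * (ψ.length * c * (powArr L L + 1)) ≤ V := by rwa [hpowL]
  have h3 := writeProg_runsTo (c := c) (q := q) (n := n) (L := L) hK hE hR hKV
    (by omega) hMV hL hL hT (hk.trans hT) henc hpow hlit (fun _ => rfl) (fun _ => rfl) hent hrhs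
    rfl hN'
  have hcols : ψ.length * c * (powArr L L + 1) ≤ V :=
    (Nat.le_mul_of_pos_left _ (by positivity)).trans hN'
  have h4 := sizeProg_runsTo (c := c) (st_bounded (show n ≤ V by omega) hMV hL hL hT hMV
    (hk.trans hT) hN' henc hpow hlit (prefixArr_le hent
    (3 * (ψ.length * c) * (ψ.length * c * (powArr L L + 1)))) (prefixArr_le hrhs
    (3 * (ψ.length * c) * (ψ.length * c * (powArr L L + 1))))) (by omega) hKV
    hcols
  have hrun := RunsTo.seq h1 (.seq h2 (.seq h3 h4))
  rw [← toInput_eq_st] at hrun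
  -- Three loops of `10 * V * U` and a final `2 * U` fit into `40 * V * U`, where `U = (2 * K * K +
  -- 1) * V`.
  refine ⟨_, hrun.mono ?_, ?_⟩
  · have h5 : 1 ≤ V := by omega
    generalize 2 * K * K + 1 = κ
    nlinarith [Nat.mul_le_mul_left (κ * V) h5]
  · have hN0 : 0 < ψ.length * c * (powArr L L + 1) := by positivity
    rw [← hpowL]
    refine renamedTo_toInput (m := 3 * (ψ.length * c)) (N := ψ.length * c * (powArr L L + 1))
      (ipEntry c ψ.length (powArr L L) (unsat q L (powArr L) (scan q ψ.encode).2.2))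
      (ipRhs c ψ.length (powArr L L)) _ (fun _ => rfl) (fun _ => rfl)
      (fun i hi => if_pos hi) (fun i hi => if_neg hi)
      (fun i hi => (if_pos (hi.trans_le (Nat.le_mul_of_pos_right _ hN0))).trans (if_pos hi))
      (fun i hi => ?_)
    change (if _ then (if _ then _ else _) else _) = 0
    split_ifs <;> rfl

theorem renameReg_injective : Function.Injective renameReg := by
  intro x y h
  unfold renameReg at h
  split_ifs at h <;> omega

theorem satProg_decidesWithin {c q n : ℕ} (hc : 0 < c) (ψ : CNFFormula n) (hM : 0 < ψ.length)
    (hψ : ∀ C ∈ ψ, C.length ≤ q) {P : Prog} {T : ℝ}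
    (hP : DecidesWithin P (IP.toInput (satMatrix c q ψ) (satVector c ψ))
      (IP.Feasible (satMatrix c q ψ) (satVector c ψ)) T) :
    DecidesWithin (satProg c q P) ψ.toInput ψ.Satisfiable
      ((2 + ψ.length + 40 * (2 * reduceConst c q * reduceConst c q + 1) *
          reduceBound c q ψ.length (n / c + 1) ^ 2 : ℕ) + T) := by
  obtain ⟨τ, ⟨t₁, ht₁, h₁⟩, hτ⟩ := reduceProg_runsTo hc ψ hM hψ
  obtain ⟨t₂, σ', h₂, ht₂, hans⟩ := hP
  obtain ⟨τ', h₃, hτ'⟩ := h₂.rename renameReg_injective (fun _ _ h => Nat.add_right_cancel h) τ hτ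
  refine ⟨_, τ', .ite_true (e := .reg 1) ?_ (.seq h₁ h₃), ?_, ?_⟩
  · change ψ.length ≠ 0
    omega
  · have hcost : (Expr.reg 1).cost ψ.toInput + 1 ≤ 2 + ψ.length := by
      have : Nat.size ψ.length ≤ ψ.length := Nat.size_le.2 Nat.lt_two_pow_self
      change 1 + Nat.size ψ.length + 1 ≤ _
      omega
    have := Nat.add_le_add hcost ht₁
    have := (Nat.cast_le (α := ℝ)).2 this
    push_cast at this ⊢
    linarith
  · have := hτ'.1 0
    change τ'.reg 0 = σ'.reg 0 at this
    rw [this, hans, feasible_satMatrix_iff hc ψ hM hψ]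

/-- The empty formula is answered directly: its integer program would have no rows, and nothing is
assumed about such inputs. -/
theorem satProg_decidesWithin_nil (c q n : ℕ) (P : Prog) :
    DecidesWithin (satProg c q P) (CNFFormula.toInput ([] : CNFFormula n))
      (CNFFormula.Satisfiable ([] : CNFFormula n)) 10 := by
  refine ⟨_, _, .ite_false (e := .reg 1) rfl (.assign _ 0 (.lit 1)), ?_, ?_⟩
  · have h1 : (Expr.reg 1).cost (CNFFormula.toInput ([] : CNFFormula n)) = 1 := by
      change 1 + Nat.size 0 = 1
      simp
    have h2 : (Expr.lit 1).cost (CNFFormula.toInput ([] : CNFFormula n)) = 2 := by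
      change 1 + Nat.size 1 = 2
      simp
    rw [h1, h2]
    norm_num
  · refine iff_of_true ?_ ⟨fun _ => true, by simp⟩
    change 1 ≠ 0
    exact one_ne_zero

end RAM

/-! ### The lower bound -/

theorem maxEntry_satVector_le (c : ℕ) {n : ℕ} (ψ : CNFFormula n) :
    IP.maxEntry (RAM.satVector c ψ) ≤ 2 ^ (n / c + 1) + c :=
  Finset.sup_le fun _ _ => slotRhs_le _ _ _ _ _ (by positivity)

/-- The bit length is bounded by the number itself; this loses only a factor `W ^ a` in the end,
which a large `c` absorbs. -/
theorem entryBits_satMatrix_le (c q : ℕ) {n : ℕ} (ψ : CNFFormula n) :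
    IP.entryBits (RAM.satMatrix c q ψ) (RAM.satVector c ψ) ≤ 2 ^ (n / c + 1) + c := by
  have hW : 1 ≤ 2 ^ (n / c + 1) := Nat.one_le_two_pow
  refine max_le (by omega) ((Nat.size_le.2 Nat.lt_two_pow_self).trans (max_le ?_
    (maxEntry_satVector_le c ψ)))
  exact Finset.sup_le fun _ _ => Finset.sup_le fun _ _ =>
    (slotEntry_le hW (unsat_le_one _ _ _ _) _ _ _ _).trans (Nat.le_add_right _ _)

theorem ipTime_le {f : ℕ → ℝ} {ε γ : ℝ} {a c k d m N β M W : ℕ} (hγ : 0 ≤ γ) (hε : 1 - ε ≤ γ)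
    (hk : k ≤ c + 4) (hW : 1 ≤ W) (hd : d ≤ W + c) (hβ : β ≤ W + c) (hm : m = 3 * (M * c))
    (hN : N = M * c * (W + 1)) :
    f k * ((d : ℝ) + 1) ^ ((1 - ε) * (k : ℝ)) * ((m : ℝ) * N * β) ^ a ≤
      ((∑ i ∈ Finset.range (c + 5), |f i|) * ((c : ℝ) + 2) ^ (γ * (c + 4)) *
        (6 * (c : ℝ) ^ 2 * (c + 2)) ^ a) * (M : ℝ) ^ (2 * a) *
          (W : ℝ) ^ (γ * (c + 4) + 2 * a) := by
  have hW' : (1 : ℝ) ≤ W := by exact_mod_cast hW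
  have hc0 : (0 : ℝ) ≤ c := Nat.cast_nonneg c
  have hd' : (d : ℝ) ≤ W + c := by exact_mod_cast hd
  have hβ' : (β : ℝ) ≤ W + c := by exact_mod_cast hβ
  have hk' : (k : ℝ) ≤ c + 4 := by exact_mod_cast hk
  -- `f` need not be monotone or non-negative; the sum of `|f i|` over all `i ≤ c + 4` is a constant
  -- above every relevant value.
  have h1 : f k ≤ ∑ i ∈ Finset.range (c + 5), |f i| :=
    (le_abs_self _).trans (Finset.single_le_sum (f := fun i => |f i|) (fun _ _ => abs_nonneg _)
      (Finset.mem_range.2 (by omega)))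
  have h1' : 0 ≤ ∑ i ∈ Finset.range (c + 5), |f i| := Finset.sum_nonneg fun _ _ => abs_nonneg _
  have h2 : ((d : ℝ) + 1) ^ ((1 - ε) * (k : ℝ)) ≤
      ((c : ℝ) + 2) ^ (γ * (c + 4)) * (W : ℝ) ^ (γ * (c + 4)) := by
    rw [← Real.mul_rpow (by positivity) (by positivity)]
    -- The base `d + 1` is at least `1`, so the exponent may be raised to `γ * (c + 4)`; moreover `d
    -- + 1 ≤ W + c + 1 ≤ (c + 2) * W`.
    have hd0 : (0 : ℝ) ≤ d := Nat.cast_nonneg d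
    refine (Real.rpow_le_rpow_of_exponent_le (by linarith) (?_ : _ ≤ γ * ((c : ℝ) + 4))).trans
      (Real.rpow_le_rpow (by linarith) (by nlinarith) (by positivity))
    exact (mul_le_mul_of_nonneg_right hε (Nat.cast_nonneg k)).trans
      (mul_le_mul_of_nonneg_left hk' hγ)
  have h3 : ((m : ℝ) * N * β) ^ a ≤
      (6 * (c : ℝ) ^ 2 * (c + 2)) ^ a * (M : ℝ) ^ (2 * a) * (W : ℝ) ^ (2 * a) := by
    rw [pow_mul, pow_mul, ← mul_pow, ← mul_pow]
    refine pow_le_pow_left₀ (by positivity) ?_ a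
    have hβ2 : (β : ℝ) ≤ (c + 2) * W := by nlinarith
    have hmN : (m : ℝ) * N ≤ 6 * (c : ℝ) ^ 2 * (M : ℝ) ^ 2 * W := by
      rw [hm, hN]
      push_cast
      have : 0 ≤ (3 : ℝ) * c ^ 2 * M ^ 2 := by positivity
      nlinarith
    refine (mul_le_mul hmN hβ2 (Nat.cast_nonneg β) (by positivity)).trans (le_of_eq ?_)
    ring
  have hW0 : (0 : ℝ) < W := by linarith
  have h4 : (W : ℝ) ^ (γ * (c + 4) + 2 * a) =
      (W : ℝ) ^ (γ * ((c : ℝ) + 4)) * (W : ℝ) ^ (2 * a) := by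
    rw [Real.rpow_add hW0, ← Real.rpow_natCast (W : ℝ) (2 * a)]
    push_cast
    rfl
  have h5 : 0 ≤ ((d : ℝ) + 1) ^ ((1 - ε) * (k : ℝ)) := by positivity
  have h6 : 0 ≤ ((m : ℝ) * N * β) ^ a := by positivity
  refine (mul_le_mul (mul_le_mul h1 h2 h5 h1') h3 h6 (by positivity)).trans (le_of_eq ?_)
  rw [h4]
  ring

theorem qSatSolvable_of_ipSolvable {f : ℕ → ℝ} {ε γ : ℝ} {a : ℕ} (hγ : 0 ≤ γ) (hγ1 : γ < 1)
    (hε : 1 - ε ≤ γ) {P : RAM.Prog}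
    (hP : ∀ (m n : ℕ) (A : Matrix (Fin m) (Fin n) ℕ) (b : Fin m → ℕ), 1 ≤ m → 1 ≤ n →
      RAM.DecidesWithin P (IP.toInput A b) (IP.Feasible A b)
        (f (IP.columnPathWidth A) *
          ((IP.maxEntry b : ℝ) + 1) ^ ((1 - ε) * (IP.columnPathWidth A : ℝ)) *
          ((m : ℝ) * (n : ℝ) * (IP.entryBits A b : ℝ)) ^ a)) (q : ℕ) :
    QSatSolvable q ((1 + γ) / 2) := by
  -- Chosen so that `c * (1 - γ) / 2 ≥ 2 * a + 6 ≥ 4 * γ + 2 * a + 2`, which is what `E / c ≤ (1 +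
  -- γ) / 2` needs. The choice is independent of `q`.
  obtain ⟨c, hcE⟩ := exists_nat_ge ((2 * a + 6) * 2 / (1 - γ))
  rw [div_le_iff₀ (by linarith)] at hcE
  have hc : 0 < c := by
    rcases Nat.eq_zero_or_pos c with rfl | h
    · have : (0 : ℝ) ≤ a := Nat.cast_nonneg a
      simp only [Nat.cast_zero, zero_mul] at hcE
      linarith
    · exact h
  have hc' : (0 : ℝ) < c := by exact_mod_cast hc
  -- The exponent of `W`: the part without the last summand comes from the algorithm for (IP), and
  -- `2` from the quadratic time of the reduction.
  let E : ℝ := γ * (c + 4) + 2 * a + 2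
  have hE0 : 0 ≤ E := by positivity
  have hE : E / c ≤ (1 + γ) / 2 := by
    rw [div_le_iff₀ hc']
    simp only [E]
    nlinarith
  let C₁ : ℝ := (∑ i ∈ Finset.range (c + 5), |f i|) * ((c : ℝ) + 2) ^ (γ * (c + 4)) *
    (6 * (c : ℝ) ^ 2 * (c + 2)) ^ a
  let K : ℝ := RAM.reduceConst c q
  have hC₁ : 0 ≤ C₁ := by
    have : 0 ≤ ∑ i ∈ Finset.range (c + 5), |f i| := Finset.sum_nonneg fun _ _ => abs_nonneg _
    positivity
  have hK : 0 ≤ K := Nat.cast_nonneg _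
  -- The `13` covers the time `10` on the empty formula and the summand `2 + M`; the other terms
  -- belong to the reduction and the algorithm for (IP).
  let C₂ : ℝ := 13 + 40 * (2 * K * K + 1) * K ^ 2 + C₁
  have hC₂ : 13 ≤ C₂ := by
    have : 0 ≤ 40 * (2 * K * K + 1) * K ^ 2 := by positivity
    simp only [C₂]
    linarith
  refine ⟨RAM.satProg c q P, C₂ * 2 ^ E, 2 * a + 4, fun n ψ hψ => ?_⟩
  have h2E : (1 : ℝ) ≤ 2 ^ E := Real.one_le_rpow (by norm_num) hE0
  rcases Nat.eq_zero_or_pos ψ.length with h0 | hM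
  · obtain rfl : ψ = [] := List.length_eq_zero_iff.1 h0
    obtain ⟨t, σ', h, ht, hans⟩ := RAM.satProg_decidesWithin_nil c q n P
    refine ⟨t, σ', h, ht.trans ?_, hans⟩
    have h1 : (1 : ℝ) ≤ 2 ^ ((1 + γ) / 2 * (n : ℝ)) :=
      Real.one_le_rpow (by norm_num) (by positivity)
    simp only [List.length_nil, Nat.cast_zero, zero_add, one_pow, mul_one]
    calc (10 : ℝ) ≤ C₂ * 1 * 1 := by linarith
      _ ≤ C₂ * 2 ^ E * 2 ^ ((1 + γ) / 2 * (n : ℝ)) := by gcongr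
  have hcols : 1 ≤ ψ.length * c * (2 ^ (n / c + 1) + 1) :=
    Nat.mul_pos (Nat.mul_pos hM hc) (Nat.succ_pos _)
  obtain ⟨t, σ', h, ht, hans⟩ := RAM.satProg_decidesWithin hc ψ hM hψ
    (hP _ _ (RAM.satMatrix c q ψ) (RAM.satVector c ψ)
      (Nat.mul_pos three_pos (Nat.mul_pos hM hc)) hcols)
  refine ⟨t, σ', h, ht.trans ?_, hans⟩
  have hpw : IP.columnPathWidth (RAM.satMatrix c q ψ) ≤ c + 4 :=
    columnPathWidth_ipMatrix_le hc hM _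
  have hT := ipTime_le (f := f) (a := a) (M := ψ.length) hγ hε hpw
    Nat.one_le_two_pow (maxEntry_satVector_le c ψ) (entryBits_satMatrix_le c q ψ) rfl rfl
  refine (add_le_add_right hT _).trans ?_
  -- The summand `1` in the block length costs the constant factor `2 ^ E`.
  have hWE : ((2 ^ (n / c + 1) : ℕ) : ℝ) ^ E ≤ 2 ^ E * 2 ^ ((1 + γ) / 2 * (n : ℝ)) := by
    have hL : ((n / c + 1 : ℕ) : ℝ) ≤ n / c + 1 := by
      push_cast
      exact add_le_add_left Nat.cast_div_le 1
    rw [Nat.cast_pow, ← Real.rpow_natCast, Nat.cast_ofNat, ← Real.rpow_mul (by norm_num),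
      ← Real.rpow_add (by norm_num)]
    refine Real.rpow_le_rpow_of_exponent_le (by norm_num) ?_
    calc ((n / c + 1 : ℕ) : ℝ) * E ≤ (n / c + 1) * E := mul_le_mul_of_nonneg_right hL hE0
      _ = E + E / c * n := by ring
      _ ≤ E + (1 + γ) / 2 * n := by gcongr
  have hW1 : (1 : ℝ) ≤ ((2 ^ (n / c + 1) : ℕ) : ℝ) := by exact_mod_cast Nat.one_le_two_pow
  have hM1 : (1 : ℝ) ≤ (ψ.length : ℝ) + 1 := by
    have : (0 : ℝ) ≤ ψ.length := Nat.cast_nonneg _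
    linarith
  have hMle : (ψ.length : ℝ) ≤ (ψ.length : ℝ) + 1 := by linarith
  have hM0 : (0 : ℝ) ≤ ψ.length := Nat.cast_nonneg _
  rw [RAM.reduceBound]
  push_cast at hWE hW1 hT ⊢
  generalize (2 : ℝ) ^ (n / c + 1) = W at *
  generalize (ψ.length : ℝ) = M at *
  have hWE1 : 1 ≤ W ^ E := Real.one_le_rpow hW1 hE0
  have hWE2 : W ^ 2 ≤ W ^ E := by
    rw [← Real.rpow_two]
    refine Real.rpow_le_rpow_of_exponent_le hW1 ?_
    have : 0 ≤ γ * ((c : ℝ) + 4) + 2 * a := by positivity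
    simp only [E]
    linarith
  have hWE3 : W ^ (γ * ((c : ℝ) + 4) + 2 * a) ≤ W ^ E :=
    Real.rpow_le_rpow_of_exponent_le hW1 (by simp only [E]; linarith)
  have hMp1 : M ≤ (M + 1) ^ (2 * a + 4) := hMle.trans (le_self_pow₀ hM1 (by omega))
  have hMp2 : M ^ 4 ≤ (M + 1) ^ (2 * a + 4) :=
    (pow_le_pow_left₀ hM0 hMle 4).trans (pow_le_pow_right₀ hM1 (by omega))
  have hMp3 : M ^ (2 * a) ≤ (M + 1) ^ (2 * a + 4) :=
    (pow_le_pow_left₀ hM0 hMle _).trans (pow_le_pow_right₀ hM1 (by omega))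
  have hMp4 : 1 ≤ (M + 1) ^ (2 * a + 4) := one_le_pow₀ hM1
  have hp0 : 0 ≤ (M + 1) ^ (2 * a + 4) := by positivity
  have hW0 : 0 ≤ W := by linarith
  have s1 : 2 + M ≤ 13 * ((M + 1) ^ (2 * a + 4) * W ^ E) := by nlinarith
  have s2 : 40 * (2 * K * K + 1) * (K * (M * M * W)) ^ 2 ≤
      40 * (2 * K * K + 1) * K ^ 2 * ((M + 1) ^ (2 * a + 4) * W ^ E) := by
    have : M ^ 4 * W ^ 2 ≤ (M + 1) ^ (2 * a + 4) * W ^ E :=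
      mul_le_mul hMp2 hWE2 (by positivity) hp0
    have h := mul_le_mul_of_nonneg_left this
      (show 0 ≤ 40 * (2 * K * K + 1) * K ^ 2 by positivity)
    refine le_trans (le_of_eq ?_) h
    ring
  have s3 : C₁ * M ^ (2 * a) * W ^ (γ * ((c : ℝ) + 4) + 2 * a) ≤
      C₁ * ((M + 1) ^ (2 * a + 4) * W ^ E) := by
    rw [mul_assoc]
    exact mul_le_mul_of_nonneg_left (mul_le_mul hMp3 hWE3 (by positivity) hp0) hC₁
  calc _ ≤ C₂ * ((M + 1) ^ (2 * a + 4) * W ^ E) := by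
        refine (add_le_add (add_le_add s1 s2) s3).trans (le_of_eq ?_)
        simp only [C₂]
        ring
    _ ≤ C₂ * ((M + 1) ^ (2 * a + 4) * (2 ^ E * 2 ^ ((1 + γ) / 2 * (n : ℝ)))) := by
        gcongr
    _ = _ := by ring

theorem theorem3 (hSETH : SETH) (f : ℕ → ℝ) (ε : ℝ) (hε : 0 < ε) (a : ℕ) :
    ¬ ∃ P : RAM.Prog, ∀ (m n : ℕ) (A : Matrix (Fin m) (Fin n) ℕ) (b : Fin m → ℕ),
      1 ≤ m → 1 ≤ n →
      RAM.DecidesWithin P (IP.toInput A b) (IP.Feasible A b)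
        (f (IP.columnPathWidth A) *
          ((IP.maxEntry b : ℝ) + 1) ^ ((1 - ε) * (IP.columnPathWidth A : ℝ)) *
          ((m : ℝ) * (n : ℝ) * (IP.entryBits A b : ℝ)) ^ a) := by
  rintro ⟨P, hP⟩
  -- For `ε > 1` the exponent `1 - ε` is negative, hence the maximum with `0`.
  have hγ1 : max 0 (1 - ε) < 1 := max_lt one_pos (by linarith)
  have hγ : 0 ≤ max 0 (1 - ε) := le_max_left _ _
  -- The bound is the same for all `q`, so it passes to the limit and gives `1 ≤ (1 + γ) / 2 < 1`.
  have hle : ∀ q, qSatExponent q ≤ (1 + max 0 (1 - ε)) / 2 := fun q =>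
    csInf_le ⟨0, fun _ h => h.1⟩
      ⟨by linarith, qSatSolvable_of_ipSolvable hγ hγ1 (le_max_right _ _) hP q⟩
  have := le_of_tendsto' hSETH hle
  linarith
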